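/- Let $d\geqslant 1$, $T>0$, $\Omega=2\pi/T$, and let $\mathbb{T}=\mathbb{R}/T\mathbb{Z}$ carry the normalized Lebesgue measure. Let $t\mapsto L_t$ be a continuous $T$-periodic family of linear maps on $\mathbb{C}^{d\times d}$, each of the standard (Kossakowski–Lindblad–Gorini–Sudarshan) form $L_t(\rho)=-i[H_t,\rho]+\sum_k\big(V_{k,t}\rho V_{k,t}^*-\tfrac12\{V_{k,t}^*V_{k,t},\rho\}\big)$ with $H_t=H_t^*$ and finitely many $V_{k,t}$. Let $\Lambda_t$ ($t\in\mathbb{R}$) solve $\dot\Lambda_t=L_t\Lambda_t$, $\Lambda_0=I$, and put $V_{t,s}=\Lambda_t\Lambda_s^{-1}$. Let $\mathscr{L}^2=L^2(\mathbb{T},\mathbb{C}^{d\times d})$ be the Bochner space for the trace norm on $\mathbb{C}^{d\times d}$, and let $\iota:\mathbb{C}^{d\times d}\,\bar\otimes\,L^2(\mathbb{T})\to\mathscr{L}^2$ be the isometric isomorphism with $\iota(a\otimes h)(t)=h(t)a$, where $\bar\otimes$ is the completion of the algebraic tensor product in the norm pulled back along $\iota$. The Fourier lifting of an operator $A$ on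 $\mathscr{L}^2$ is $\tilde A=\iota^{-1}A\,\iota$ with domain $\iota^{-1}(D(A))$. Let $L$ be the bounded operator $(Lf)(t)=L_t(f(t))$, let $\partial=d/dt$ with domain $C^1(\mathbb{T},\mathbb{C}^{d\times d})$, and let $\mathcal{L}=L-\partial$ with the same domain. With $e_n(t)=e^{in\Omega t}$ let $F_z$ be the self-adjoint operator on $L^2(\mathbb{T})$ with $F_ze_n=ne_n$, and let $(I\otimes F_z)\sum_n f_n\otimes e_n=\sum_n f_n\otimes ne_n$ on the domain where the last series converges unconditionally. An operator $A$ on $\mathscr{L}^2$ is completely positive if for every $n$ its entrywise action on $M_n(\mathscr{L}^2)$ preserves the cone $P_n^+$ of those elements of $M_n(\mathscr{L}^2)$ that are, almost everywhere, finite sums $\sum_j g_j(t)^*g_j(t)$ with $g_j\in M_n(\mathscr{L}^2)$; it is trace preserving if it preserves $\frac1T\int_{\mathbb{T}}\operatorname{Tr}f(t)\,dt$. Both notions are carried to $\mathbb{C}^{d\times d}\,\bar\otimes\,L^2(\mathbb{T})$ by $\iota$. Theorem. The evolution is CP-divisible: $V_{t,s}$ is completely positive and trace preserving for all $s\leqslant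 t$. For every $\tau\geqslant0$, $$W_\tau(f)(t)=V_{t,t-\tau}(f(t-\tau))$$ defines a bounded operator on $\mathscr{L}^2$, and: 1. $\{W_\tau\}_{\tau\geqslant0}$ is a contraction $C_0$-semigroup of completely positive, trace preserving maps on $\mathscr{L}^2$. The operator $\mathcal{L}$ is closable and the infinitesimal generator of $\{W_\tau\}$ is its closure $\overline{\mathcal{L}}$; in particular it equals $L-\partial$ on $C^1(\mathbb{T},\mathbb{C}^{d\times d})$. 2. The Fourier liftings $\{\tilde W_\tau\}_{\tau\geqslant0}$ form a contraction $C_0$-semigroup of completely positive, trace preserving maps on $\mathbb{C}^{d\times d}\,\bar\otimes\,L^2(\mathbb{T})$. The lifting $\tilde{\mathcal{L}}$ is closable, it is the restriction of $\tilde L-i\Omega\,I\otimes F_z$ to $\iota^{-1}(C^1(\mathbb{T},\mathbb{C}^{d\times d}))$, and the infinitesimal generator of $\{\tilde W_\tau\}$ is its closure, which is $\tilde L-i\Omega\,I\otimes F_z$ on the whole domain of $I\otimes F_z$. Both semigroups are strongly differentiable: if $G$ is the generator of $S_\tau=W_\tau$ or $S_\tau=\tilde W_\tau$, then $D(G)$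 is dense and, for $x\in D(G)$, $S_\tau x\in D(G)$ and $\tau\mapsto S_\tau x$ is differentiable on $[0,\infty)$ with derivative $G S_\tau x$. -/

import Mathlib

open MeasureTheory Filter Topology
open scoped ENNReal NNReal InnerProductSpace TensorProduct ComplexOrder

set_option linter.unusedSectionVars false

namespace Howland

/-- The trace norm `‖a‖₁ = Tr √(a* a)`. -/
noncomputable def traceNorm {d : ℕ} (a : Matrix (Fin d) (Fin d) ℂ) : ℝ :=
  (Matrix.trace (cfc Real.sqrt (a.conjTranspose * a))).re

namespace traceNorm

variable {d : ℕ}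

/-- An orthonormal eigenbasis of `a* a`. -/
noncomputable def rightBasis (a : Matrix (Fin d) (Fin d) ℂ) :
    OrthonormalBasis (Fin d) ℂ (EuclideanSpace ℂ (Fin d)) :=
  (Matrix.isHermitian_conjTranspose_mul_self a).eigenvectorBasis

theorem inner_apply_rightBasis (a : Matrix (Fin d) (Fin d) ℂ) (i j : Fin d) :
    ⟪Matrix.toEuclideanLin a (rightBasis a i), Matrix.toEuclideanLin a (rightBasis a j)⟫_ℂ
      = if i = j then
        ((Matrix.isHermitian_conjTranspose_mul_self a).eigenvalues j : ℂ) else 0 := by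
  set h := Matrix.isHermitian_conjTranspose_mul_self a with hh
  rw [← LinearMap.adjoint_inner_right, ← Matrix.toEuclideanLin_conjTranspose_eq_adjoint]
  have : Matrix.toEuclideanLin a.conjTranspose (Matrix.toEuclideanLin a (rightBasis a j))
      = (h.eigenvalues j : ℂ) • rightBasis a j := by
    apply WithLp.ofLp_injective 2
    simp only [Matrix.ofLp_toLpLin, Matrix.toLin'_apply, Matrix.mulVec_mulVec,
      WithLp.ofLp_smul]
    rw [rightBasis, h.mulVec_eigenvectorBasis j]
    ext k
    simp
  rw [this, inner_smul_right, orthonormal_iff_ite.1 (rightBasis a).orthonormal]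
  simp

theorem eq_sum_norm (a : Matrix (Fin d) (Fin d) ℂ) :
    traceNorm a = ∑ i, ‖Matrix.toEuclideanLin a (rightBasis a i)‖ := by
  set h := Matrix.isHermitian_conjTranspose_mul_self a with hh
  have h1 : traceNorm a = ∑ i, √(h.eigenvalues i) := by
    rw [traceNorm, h.cfc_eq, Matrix.IsHermitian.cfc, Unitary.conjStarAlgAut_apply,
      Matrix.trace_mul_comm, ← mul_assoc]
    simp [Matrix.trace]
  rw [h1]
  refine Finset.sum_congr rfl fun i _ => ?_
  rw [Real.sqrt_eq_iff_mul_self_eq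
    ((Matrix.posSemidef_conjTranspose_mul_self a).eigenvalues_nonneg i) (norm_nonneg _), ← sq]
  have h3 := inner_apply_rightBasis a i i
  rw [inner_self_eq_norm_sq_to_K, if_pos rfl] at h3
  refine Complex.ofReal_injective ?_
  simpa using h3.symm

theorem re_sum_inner_le (a : Matrix (Fin d) (Fin d) ℂ)
    (e : OrthonormalBasis (Fin d) ℂ (EuclideanSpace ℂ (Fin d)))
    (B : EuclideanSpace ℂ (Fin d) →ₗ[ℂ] EuclideanSpace ℂ (Fin d)) (hB : ∀ x, ‖B x‖ ≤ ‖x‖) :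
    (∑ i, ⟪B (e i), Matrix.toEuclideanLin a (e i)⟫_ℂ).re ≤ traceNorm a := by
  have key : ∀ b : OrthonormalBasis (Fin d) ℂ (EuclideanSpace ℂ (Fin d)),
      ∑ i, ⟪B (b i), Matrix.toEuclideanLin a (b i)⟫_ℂ
        = LinearMap.trace ℂ _ (LinearMap.adjoint B ∘ₗ Matrix.toEuclideanLin a) := by
    intro b
    rw [LinearMap.trace_eq_sum_inner _ b]
    simp [LinearMap.adjoint_inner_right]
  rw [key e, ← key (rightBasis a), eq_sum_norm, Complex.re_sum]
  refine Finset.sum_le_sum fun i _ => ?_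
  refine (Complex.re_le_norm _).trans ((norm_inner_le_norm _ _).trans ?_)
  have := hB (rightBasis a i)
  rw [(rightBasis a).norm_eq_one] at this
  exact mul_le_of_le_one_left (norm_nonneg _) this

theorem exists_contraction (a : Matrix (Fin d) (Fin d) ℂ) :
    ∃ B : EuclideanSpace ℂ (Fin d) →ₗ[ℂ] EuclideanSpace ℂ (Fin d), (∀ x, ‖B x‖ ≤ ‖x‖) ∧
      ∀ e : OrthonormalBasis (Fin d) ℂ (EuclideanSpace ℂ (Fin d)),
      (∑ i, ⟪B (e i), Matrix.toEuclideanLin a (e i)⟫_ℂ).re = traceNorm a := by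
  set A := Matrix.toEuclideanLin a with hA
  set v := rightBasis a with hv
  set u : Fin d → EuclideanSpace ℂ (Fin d) := fun i => ((‖A (v i)‖⁻¹ : ℝ) : ℂ) • A (v i) with hu
  have hu1 : ∀ i, ‖u i‖ ≤ 1 := fun i => by
    rw [hu]
    simp only [norm_smul, Complex.norm_real, norm_inv, norm_norm]
    exact inv_mul_le_one
  have hu2 : ∀ i j, i ≠ j → ⟪u i, u j⟫_ℂ = 0 := fun i j hij => by
    simp only [hu, inner_smul_left, inner_smul_right]
    rw [hA, hv, inner_apply_rightBasis, if_neg hij]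
    simp
  let B : EuclideanSpace ℂ (Fin d) →ₗ[ℂ] EuclideanSpace ℂ (Fin d) :=
    ∑ i, (innerₛₗ ℂ (v i)).smulRight (u i)
  have hBx : ∀ x, B x = ∑ i, ⟪v i, x⟫_ℂ • u i := fun x => by simp [B]
  have hBv : ∀ i, B (v i) = u i := fun i => by
    rw [hBx, Finset.sum_eq_single i]
    · rw [orthonormal_iff_ite.1 v.orthonormal, if_pos rfl, one_smul]
    · intro j _ hj
      rw [orthonormal_iff_ite.1 v.orthonormal, if_neg hj, zero_smul]
    · simp
  refine ⟨B, fun x => ?_, fun e => ?_⟩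
  · have h1 : ⟪B x, B x⟫_ℂ = ((∑ i, ‖⟪v i, x⟫_ℂ‖ ^ 2 * ‖u i‖ ^ 2 : ℝ) : ℂ) := by
      rw [hBx, sum_inner, Complex.ofReal_sum]
      refine Finset.sum_congr rfl fun i _ => ?_
      rw [inner_sum, Finset.sum_eq_single i]
      · rw [inner_smul_left, inner_smul_right, inner_self_eq_norm_sq_to_K, ← mul_assoc,
          RCLike.conj_mul]
        push_cast
        rfl
      · intro j _ hj
        rw [inner_smul_left, inner_smul_right, hu2 i j hj.symm]
        simp
      · simp
    rw [inner_self_eq_norm_sq_to_K] at h1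
    have h2 : ‖B x‖ ^ 2 = ∑ i, ‖⟪v i, x⟫_ℂ‖ ^ 2 * ‖u i‖ ^ 2 :=
      Complex.ofReal_injective (by simpa using h1)
    refine le_of_sq_le_sq ?_ (norm_nonneg x)
    rw [h2, ← v.sum_sq_norm_inner_right x]
    refine Finset.sum_le_sum fun i _ => mul_le_of_le_one_right (sq_nonneg _) ?_
    exact pow_le_one₀ (norm_nonneg _) (hu1 i)
  · have key : ∀ b : OrthonormalBasis (Fin d) ℂ (EuclideanSpace ℂ (Fin d)),
        ∑ i, ⟪B (b i), A (b i)⟫_ℂ = LinearMap.trace ℂ _ (LinearMap.adjoint B ∘ₗ A) := by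
      intro b
      rw [LinearMap.trace_eq_sum_inner _ b]
      simp [LinearMap.adjoint_inner_right]
    rw [key e, ← key v, eq_sum_norm, Complex.re_sum]
    refine Finset.sum_congr rfl fun i _ => ?_
    rw [hBv, inner_smul_left, inner_self_eq_norm_sq_to_K]
    by_cases h0 : ‖A (v i)‖ = 0
    · simp [← hA, ← hv, h0]
    · have : (starRingEnd ℂ) ((‖A (v i)‖⁻¹ : ℝ) : ℂ) * ((‖A (v i)‖ : ℝ) : ℂ) ^ 2
          = ((‖A (v i)‖ : ℝ) : ℂ) := by
        rw [Complex.conj_ofReal, ← Complex.ofReal_pow, ← Complex.ofReal_mul]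
        congr 1
        field_simp
      exact congrArg Complex.re this

theorem le_sum_norm (a : Matrix (Fin d) (Fin d) ℂ)
    (e : OrthonormalBasis (Fin d) ℂ (EuclideanSpace ℂ (Fin d))) :
    traceNorm a ≤ ∑ i, ‖Matrix.toEuclideanLin a (e i)‖ := by
  obtain ⟨B, hB, h⟩ := exists_contraction a
  rw [← h e, Complex.re_sum]
  refine Finset.sum_le_sum fun i _ => ?_
  refine (Complex.re_le_norm _).trans ((norm_inner_le_norm _ _).trans ?_)
  have := hB (e i)
  rw [e.norm_eq_one] at this
  exact mul_le_of_le_one_left (norm_nonneg _) this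

theorem add_le (a b : Matrix (Fin d) (Fin d) ℂ) :
    traceNorm (a + b) ≤ traceNorm a + traceNorm b := by
  obtain ⟨B, hB, h⟩ := exists_contraction (a + b)
  rw [← h (rightBasis a)]
  simp only [map_add, LinearMap.add_apply, inner_add_right, Finset.sum_add_distrib,
    Complex.add_re]
  exact add_le_add (re_sum_inner_le a _ B hB) (re_sum_inner_le b _ B hB)

theorem smul_le (c : ℂ) (a : Matrix (Fin d) (Fin d) ℂ) :
    traceNorm (c • a) ≤ ‖c‖ * traceNorm a := by
  refine (le_sum_norm _ (rightBasis a)).trans_eq ?_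
  rw [eq_sum_norm, Finset.mul_sum]
  simp [norm_smul]

theorem zero : traceNorm (0 : Matrix (Fin d) (Fin d) ℂ) = 0 := by
  rw [eq_sum_norm]; simp

theorem eq_zero {a : Matrix (Fin d) (Fin d) ℂ} (h : traceNorm a = 0) : a = 0 := by
  rw [eq_sum_norm, Finset.sum_eq_zero_iff_of_nonneg fun _ _ => norm_nonneg _] at h
  apply Matrix.toEuclideanLin.injective
  rw [map_zero]
  refine (rightBasis a).toBasis.ext fun i => ?_
  simpa using h i (Finset.mem_univ i)

theorem neg (a : Matrix (Fin d) (Fin d) ℂ) : traceNorm (-a) = traceNorm a := by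
  have h : ∀ x : Matrix (Fin d) (Fin d) ℂ, traceNorm (-x) ≤ traceNorm x := fun x => by
    simpa using smul_le (-1) x
  exact le_antisymm (h a) (by simpa using h (-a))

end traceNorm

/-- The space of complex `d × d` matrices, normed by the trace norm. -/
def TraceMat (d : ℕ) : Type := Matrix (Fin d) (Fin d) ℂ

namespace TraceMat

variable {d : ℕ}

noncomputable instance instAddCommGroup : AddCommGroup (TraceMat d) :=
  inferInstanceAs (AddCommGroup (Matrix (Fin d) (Fin d) ℂ))

noncomputable instance instModule : Module ℂ (TraceMat d) :=
  inferInstanceAs (Module ℂ (Matrix (Fin d) (Fin d) ℂ))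

/-- The underlying matrix. -/
noncomputable def mat : TraceMat d ≃ₗ[ℂ] Matrix (Fin d) (Fin d) ℂ := LinearEquiv.refl ℂ _

noncomputable instance instNormedAddCommGroup : NormedAddCommGroup (TraceMat d) :=
  AddGroupNorm.toNormedAddCommGroup
    { toFun := fun a => traceNorm (mat a)
      map_zero' := by simpa using traceNorm.zero
      add_le' := fun a b => by simpa using traceNorm.add_le (mat a) (mat b)
      neg' := fun a => by simpa using traceNorm.neg (mat a)
      eq_zero_of_map_eq_zero' := fun a h => by simpa using traceNorm.eq_zero h }

theorem norm_def (a : TraceMat d) : ‖a‖ = traceNorm (mat a) := rfl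

noncomputable instance instNormedSpace : NormedSpace ℂ (TraceMat d) where
  norm_smul_le c a := by
    rw [norm_def, norm_def, map_smul]
    exact traceNorm.smul_le c (mat a)

instance instFiniteDimensional : FiniteDimensional ℂ (TraceMat d) :=
  mat.symm.finiteDimensional

noncomputable instance instCompleteSpace : CompleteSpace (TraceMat d) :=
  FiniteDimensional.complete ℂ _

end TraceMat

section MatrixMaps

variable {d : ℕ}

/-- A matrix of `d × d` matrices, read as one matrix of complex numbers. -/
noncomputable def blockMat {n : ℕ} (B : Matrix (Fin n) (Fin n) (TraceMat d)) :
    Matrix (Fin n × Fin d) (Fin n × Fin d) ℂ :=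
  Matrix.of fun p q => TraceMat.mat (B p.1 q.1) p.2 q.2

/-- Complete positivity of a linear map on matrices. -/
def IsCP (A : TraceMat d →L[ℂ] TraceMat d) : Prop :=
  ∀ (n : ℕ) (B : Matrix (Fin n) (Fin n) (TraceMat d)),
    (blockMat B).PosSemidef → (blockMat (B.map A)).PosSemidef

/-- Trace preservation of a linear map on matrices. -/
def IsTP (A : TraceMat d →L[ℂ] TraceMat d) : Prop :=
  ∀ a, (TraceMat.mat (A a)).trace = (TraceMat.mat a).trace

/-- The standard (Kossakowski–Lindblad–Gorini–Sudarshan) form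
`ρ ↦ -i[H, ρ] + ∑ₖ (Vₖ ρ Vₖ* - ½ {Vₖ* Vₖ, ρ})` with `H = H*`. -/
def IsStandardForm (A : TraceMat d →L[ℂ] TraceMat d) : Prop :=
  ∃ (H : Matrix (Fin d) (Fin d) ℂ) (r : ℕ) (V : Fin r → Matrix (Fin d) (Fin d) ℂ),
    H.IsHermitian ∧ ∀ a : TraceMat d,
      TraceMat.mat (A a) = (-Complex.I) • (H * TraceMat.mat a - TraceMat.mat a * H) +
        ∑ k, (V k * TraceMat.mat a * (V k).conjTranspose -
          (1 / 2 : ℂ) • ((V k).conjTranspose * V k * TraceMat.mat a +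
            TraceMat.mat a * ((V k).conjTranspose * V k)))

/-- The propagator `V_{t,s} = Λ_t Λ_s⁻¹`. -/
noncomputable def propagator (Lam : ℝ → TraceMat d →L[ℂ] TraceMat d) (t s : ℝ) :
    TraceMat d →L[ℂ] TraceMat d :=
  Lam t * Ring.inverse (Lam s)

end MatrixMaps

section Spaces

variable (d : ℕ) (T : ℝ) [Fact (0 < T)]

/-- The Bochner space `L²(𝕋, ℂ^{d×d})`, `𝕋 = ℝ / Tℤ` with normalized Lebesgue measure. -/
abbrev FloquetSpace : Type := Lp (TraceMat d) 2 (@AddCircle.haarAddCircle T _)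

/-- The algebraic tensor product `ℂ^{d×d} ⊗ L²(𝕋)`. -/
def AlgTensor : Type := TraceMat d ⊗[ℂ] Lp ℂ 2 (@AddCircle.haarAddCircle T _)

noncomputable instance : AddCommGroup (AlgTensor d T) :=
  inferInstanceAs (AddCommGroup (TraceMat d ⊗[ℂ] Lp ℂ 2 (@AddCircle.haarAddCircle T _)))

noncomputable instance : Module ℂ (AlgTensor d T) :=
  inferInstanceAs (Module ℂ (TraceMat d ⊗[ℂ] Lp ℂ 2 (@AddCircle.haarAddCircle T _)))

variable {d T}

/-- `a ⊙ h`, the function `t ↦ h(t) a`. -/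
noncomputable def odot (a : TraceMat d) :
    Lp ℂ 2 (@AddCircle.haarAddCircle T _) →L[ℂ] FloquetSpace d T :=
  ((ContinuousLinearMap.id ℂ ℂ).smulRight a).compLpL 2 _

theorem odot_coeFn (a : TraceMat d) (h : Lp ℂ 2 (@AddCircle.haarAddCircle T _)) :
    odot a h =ᵐ[AddCircle.haarAddCircle] fun t => h t • a :=
  ContinuousLinearMap.coeFn_compLpL _ h

/-- The injection `ι (a ⊗ h) = a ⊙ h` of the algebraic tensor product. -/
noncomputable def algIota : AlgTensor d T →ₗ[ℂ] FloquetSpace d T :=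
  TensorProduct.lift
    (LinearMap.mk₂ ℂ (fun a (h : Lp ℂ 2 (@AddCircle.haarAddCircle T _)) =>
        (odot a h : FloquetSpace d T))
      (fun a b h => by
        refine Lp.ext ?_
        filter_upwards [odot_coeFn (a + b) h, odot_coeFn a h, odot_coeFn b h,
          Lp.coeFn_add (odot a h) (odot b h)] with t h1 h2 h3 h4
        rw [h1, h4, Pi.add_apply, h2, h3, smul_add])
      (fun c a h => by
        refine Lp.ext ?_
        filter_upwards [odot_coeFn (c • a) h, odot_coeFn a h,
          Lp.coeFn_smul c (odot a h)] with t h1 h2 h3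
        rw [h1, h3, Pi.smul_apply, h2, smul_comm])
      (fun a h k => map_add _ _ _) (fun c a h => map_smul _ _ _))

/-- The simple tensor `a ⊗ h`. -/
noncomputable def AlgTensor.tmul (a : TraceMat d) (h : Lp ℂ 2 (@AddCircle.haarAddCircle T _)) :
    AlgTensor d T := a ⊗ₜ[ℂ] h

theorem algIota_tmul (a : TraceMat d) (h : Lp ℂ 2 (@AddCircle.haarAddCircle T _)) :
    algIota (AlgTensor.tmul a h) = odot a h := rfl

theorem algIota_surjective : Function.Surjective (algIota : AlgTensor d T → FloquetSpace d T) := by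
  intro f
  let b := Module.finBasis ℂ (TraceMat d)
  let c : Fin (Module.finrank ℂ (TraceMat d)) → (TraceMat d →L[ℂ] ℂ) := fun i =>
    LinearMap.toContinuousLinearMap (b.coord i)
  refine ⟨∑ i, AlgTensor.tmul (b i) ((c i).compLp f), ?_⟩
  rw [map_sum]
  simp only [algIota_tmul]
  refine Lp.ext ?_
  have h1 : ∀ᵐ t ∂(@AddCircle.haarAddCircle T _), ∀ i,
      odot (b i) ((c i).compLp f) t = c i (f t) • b i := by
    rw [ae_all_iff]
    intro i
    filter_upwards [odot_coeFn (b i) ((c i).compLp f), (c i).coeFn_compLp f] with t h2 h3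
    rw [h2, h3]
  filter_upwards [Lp.coeFn_finsetSum Finset.univ fun i => odot (b i) ((c i).compLp f), h1]
    with t h2 h3
  rw [h2]
  simp only [Finset.sum_apply, h3]
  exact b.sum_repr (f t)

/-- The norm of the algebraic tensor product is pulled back along `ι`. -/
noncomputable instance : SeminormedAddCommGroup (AlgTensor d T) :=
  SeminormedAddCommGroup.induced _ _ (algIota : AlgTensor d T →ₗ[ℂ] FloquetSpace d T)

theorem norm_algIota (x : AlgTensor d T) : ‖algIota x‖ = ‖x‖ := rfl

noncomputable instance : NormedSpace ℂ (AlgTensor d T) where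
  norm_smul_le c x := by
    rw [← norm_algIota, ← norm_algIota, map_smul, norm_smul]

variable (d T) in
/-- The completed tensor product `ℂ^{d×d} ⊗̄ L²(𝕋)`. -/
abbrev FloquetTensor : Type := UniformSpace.Completion (AlgTensor d T)

/-- The simple tensor `a ⊗ h`, as an element of the completed tensor product. -/
noncomputable def tensor (a : TraceMat d) (h : Lp ℂ 2 (@AddCircle.haarAddCircle T _)) :
    FloquetTensor d T :=
  ((AlgTensor.tmul a h : AlgTensor d T) : FloquetTensor d T)

theorem tensor_add_left (a b : TraceMat d) (h : Lp ℂ 2 (@AddCircle.haarAddCircle T _)) :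
    tensor (a + b) h = tensor a h + tensor b h := by
  rw [tensor, tensor, tensor, ← UniformSpace.Completion.coe_add]
  exact congrArg _ (TensorProduct.add_tmul _ _ _)

theorem tensor_smul_left (c : ℂ) (a : TraceMat d) (h : Lp ℂ 2 (@AddCircle.haarAddCircle T _)) :
    tensor (c • a) h = c • tensor a h := by
  rw [tensor, tensor, ← UniformSpace.Completion.coe_smul]
  exact congrArg _ (TensorProduct.smul_tmul' _ _ _).symm

/-- The continuous extension of the injection to the completion. -/
noncomputable def iotaL : FloquetTensor d T →L[ℂ] FloquetSpace d T :=
  (LinearIsometry.mk (algIota : AlgTensor d T →ₗ[ℂ] FloquetSpace d T)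
    norm_algIota).toContinuousLinearMap.extend UniformSpace.Completion.toComplL

theorem iotaL_coe (x : AlgTensor d T) : iotaL (x : FloquetTensor d T) = algIota x :=
  ContinuousLinearMap.extend_eq _ (e := UniformSpace.Completion.toComplL)
    UniformSpace.Completion.denseRange_coe
    (UniformSpace.Completion.isUniformInducing_coe _) x

theorem norm_iotaL (x : FloquetTensor d T) : ‖iotaL x‖ = ‖x‖ := by
  induction x using UniformSpace.Completion.induction_on with
  | hp => exact isClosed_eq (by fun_prop) (by fun_prop)
  | ih x => rw [iotaL_coe, norm_algIota, UniformSpace.Completion.norm_coe]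

/-- The isometric isomorphism `ι : ℂ^{d×d} ⊗̄ L²(𝕋) → L²(𝕋, ℂ^{d×d})` with
`ι (a ⊗ h) = a ⊙ h`. -/
noncomputable def iota : FloquetTensor d T ≃ₗᵢ[ℂ] FloquetSpace d T :=
  LinearIsometryEquiv.ofSurjective ⟨iotaL.toLinearMap, norm_iotaL⟩ fun f => by
    obtain ⟨x, hx⟩ := algIota_surjective f
    exact ⟨x, (iotaL_coe x).trans hx⟩

theorem iota_tensor (a : TraceMat d) (h : Lp ℂ 2 (@AddCircle.haarAddCircle T _)) :
    iota (tensor a h) = odot a h :=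
  (iotaL_coe _).trans (algIota_tmul a h)

end Spaces

section Operators

variable {d : ℕ} {T : ℝ} [Fact (0 < T)]

/-- The bounded operator `(A f)(t) = A_t (f(t))` given by a continuous periodic family `A_t`. -/
noncomputable def pointwiseOp (A : C(AddCircle T, TraceMat d →L[ℂ] TraceMat d)) :
    FloquetSpace d T →L[ℂ] FloquetSpace d T :=
  (ContinuousLinearMap.id ℂ (TraceMat d →L[ℂ] TraceMat d)).holderL AddCircle.haarAddCircle ∞ 2 2
    (ContinuousMap.toLp ∞ AddCircle.haarAddCircle ℂ A)

theorem pointwiseOp_coeFn (A : C(AddCircle T, TraceMat d →L[ℂ] TraceMat d))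
    (f : FloquetSpace d T) :
    pointwiseOp A f =ᵐ[AddCircle.haarAddCircle] fun t => A t (f t) := by
  have h := (ContinuousLinearMap.id ℂ (TraceMat d →L[ℂ] TraceMat d)).coeFn_holder (r := 2)
    (ContinuousMap.toLp ∞ AddCircle.haarAddCircle ℂ A) f
  filter_upwards [h, ContinuousMap.coeFn_toLp (p := ∞) (𝕜 := ℂ) AddCircle.haarAddCircle A]
    with t h1 h2
  rw [← h2]
  exact h1

/-- The inclusion of the continuous functions into the Bochner space. -/
noncomputable def contToFloquet : C(AddCircle T, TraceMat d) →L[ℂ] FloquetSpace d T :=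
  ContinuousMap.toLp 2 AddCircle.haarAddCircle ℂ

/-- The same inclusion, as a linear map. -/
noncomputable def contToFloquetₗ : C(AddCircle T, TraceMat d) →ₗ[ℂ] FloquetSpace d T :=
  (contToFloquet (d := d) (T := T)).toLinearMap

theorem contToFloquet_injective :
    Function.Injective (contToFloquetₗ (d := d) (T := T)) :=
  ContinuousMap.toLp_injective _

variable (d T) in
/-- The space `C¹(𝕋, ℂ^{d×d})`, as a space of continuous functions. -/
noncomputable def circleC1 : Submodule ℂ C(AddCircle T, TraceMat d) where
  carrier := {f | ContDiff ℝ 1 fun t : ℝ => f (t : AddCircle T)}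
  add_mem' hf hg := by
    rw [Set.mem_ofPred_eq] at *
    exact hf.add hg
  zero_mem' := by
    rw [Set.mem_ofPred_eq]
    exact contDiff_const (c := (0 : TraceMat d))
  smul_mem' c _ hf := by
    rw [Set.mem_ofPred_eq] at *
    exact hf.const_smul c

theorem contDiff_of_mem (f : circleC1 d T) :
    ContDiff ℝ 1 fun t : ℝ => f.1 (t : AddCircle T) := f.2

theorem periodic_deriv (f : C(AddCircle T, TraceMat d)) :
    Function.Periodic (deriv fun t : ℝ => f (t : AddCircle T)) T := by
  intro t
  rw [← deriv_comp_add_const]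
  simp

/-- The derivative of a continuously differentiable function on the circle. -/
noncomputable def circleDeriv : circleC1 d T →ₗ[ℂ] C(AddCircle T, TraceMat d) where
  toFun f := ⟨(periodic_deriv f.1).lift,
    Continuous.quotient_lift (contDiff_of_mem f).continuous_deriv_one _⟩
  map_add' f g := by
    ext x
    induction x using QuotientAddGroup.induction_on with | _ t
    exact deriv_add ((contDiff_of_mem f).differentiable one_ne_zero t) ((contDiff_of_mem g).differentiable one_ne_zero t)
  map_smul' c f := by
    ext x
    induction x using QuotientAddGroup.induction_on with | _ t
    exact deriv_const_smul c ((contDiff_of_mem f).differentiable one_ne_zero t)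

theorem circleDeriv_coe (f : circleC1 d T) (t : ℝ) :
    circleDeriv f (t : AddCircle T) = deriv (fun s : ℝ => f.1 (s : AddCircle T)) t := rfl

variable (d T) in
/-- The subspace `C¹(𝕋, ℂ^{d×d})` of the Bochner space. -/
noncomputable def C1Space : Submodule ℂ (FloquetSpace d T) :=
  (circleC1 d T).map contToFloquetₗ

variable (d T) in
/-- The derivative operator `∂` on the Bochner space, with domain `C¹(𝕋, ℂ^{d×d})`. -/
noncomputable def derivOp : FloquetSpace d T →ₗ.[ℂ] FloquetSpace d T where
  domain := C1Space d T
  toFun := contToFloquetₗ ∘ₗ circleDeriv ∘ₗ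
    ((circleC1 d T).equivMapOfInjective
      contToFloquetₗ
      contToFloquet_injective).symm.toLinearMap

/-- The generalized Lindbladian `𝓛 = L - ∂` with domain `C¹(𝕋, ℂ^{d×d})`. -/
noncomputable def generalizedLindbladian (L : C(AddCircle T, TraceMat d →L[ℂ] TraceMat d)) :
    FloquetSpace d T →ₗ.[ℂ] FloquetSpace d T :=
  (pointwiseOp L : FloquetSpace d T →ₗ[ℂ] FloquetSpace d T) +ᵥ (-derivOp d T)

/-- The Fourier lifting `ι⁻¹ ∘ A ∘ ι` of a bounded operator. -/
noncomputable def fourierLift (A : FloquetSpace d T →L[ℂ] FloquetSpace d T) :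
    FloquetTensor d T →L[ℂ] FloquetTensor d T :=
  (iota (d := d) (T := T)).symm.toContinuousLinearEquiv.toContinuousLinearMap ∘L A ∘L
    (iota (d := d) (T := T)).toContinuousLinearEquiv.toContinuousLinearMap

theorem fourierLift_apply (A : FloquetSpace d T →L[ℂ] FloquetSpace d T) (x : FloquetTensor d T) :
    fourierLift A x = iota.symm (A (iota x)) := rfl

/-- The Fourier lifting `ι⁻¹ ∘ A ∘ ι`, with domain `ι⁻¹(D(A))`, of a partially defined operator. -/
noncomputable def liftPMap (A : FloquetSpace d T →ₗ.[ℂ] FloquetSpace d T) :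
    FloquetTensor d T →ₗ.[ℂ] FloquetTensor d T where
  domain := A.domain.comap (iota (d := d) (T := T)).toLinearEquiv.toLinearMap
  toFun := (iota (d := d) (T := T)).symm.toLinearEquiv.toLinearMap ∘ₗ A.toFun ∘ₗ
    (iota (d := d) (T := T)).toLinearEquiv.toLinearMap.restrict fun _ hx => hx

theorem liftPMap_apply (A : FloquetSpace d T →ₗ.[ℂ] FloquetSpace d T)
    (x : (liftPMap A).domain) : liftPMap A x = iota.symm (A ⟨iota x.1, x.2⟩) := rfl

/-- The term `fₙ ⊗ F_z eₙ = fₙ ⊗ n eₙ` of the series `∑ₙ fₙ ⊗ F_z eₙ`, where `fₙ` are the Fourier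
coefficients of `f = ι x`, so that `x = ∑ₙ fₙ ⊗ eₙ`. -/
noncomputable def numberTerm (n : ℤ) : FloquetTensor d T →ₗ[ℂ] FloquetTensor d T where
  toFun x := tensor (fourierCoeff (iota x : AddCircle T → TraceMat d) n) ((n : ℂ) • fourierLp 2 n)
  map_add' x y := by
    have hi : ∀ f : FloquetSpace d T, Integrable f AddCircle.haarAddCircle := fun f =>
      (Lp.memLp f).integrable (by norm_num)
    rw [← tensor_add_left, ← Pi.add_apply, ← fourierCoeff.add (hi _) (hi _), map_add]
    rw [fourierCoeff_congr_ae (Lp.coeFn_add (iota x) (iota y))]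
  map_smul' c x := by
    rw [RingHom.id_apply, ← tensor_smul_left, ← fourierCoeff.const_smul, map_smul]
    rw [fourierCoeff_congr_ae (Lp.coeFn_smul c (iota x))]

variable (d T) in
/-- The operator `I ⊗ F_z`, `(I ⊗ F_z)(∑ₙ fₙ ⊗ eₙ) = ∑ₙ fₙ ⊗ F_z eₙ` with `F_z eₙ = n eₙ`, on its
natural domain, where `F_z` is the self-adjoint Fourier number operator. -/
noncomputable def idTensorNumber : FloquetTensor d T →ₗ.[ℂ] FloquetTensor d T where
  domain :=
    { carrier := {x | Summable fun n : ℤ => numberTerm n x}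
      add_mem' := fun hx hy => by simpa using Summable.add hx hy
      zero_mem' := by simp
      smul_mem' := fun c x hx => by simpa using Summable.const_smul c hx }
  toFun :=
    { toFun := fun x => ∑' n : ℤ, numberTerm n x.1
      map_add' := fun x y => by simpa using Summable.tsum_add x.2 y.2
      map_smul' := fun c x => by simpa using Summable.tsum_const_smul c x.2 }

/-- The operator `L̃ - iΩ I ⊗ F_z`, `Ω = 2π / T`, with the domain of `I ⊗ F_z`. -/
noncomputable def liftedLindbladian (L : C(AddCircle T, TraceMat d →L[ℂ] TraceMat d)) :
    FloquetTensor d T →ₗ.[ℂ] FloquetTensor d T :=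
  (fourierLift (pointwiseOp L) : FloquetTensor d T →ₗ[ℂ] FloquetTensor d T) +ᵥ
    (-((Complex.I * (2 * Real.pi / T : ℝ)) • idTensorNumber d T))

end Operators

section Positivity

variable {d : ℕ} {T : ℝ} [Fact (0 < T)]

/-- The cone `P_n⁺` of the finite sums `∑ⱼ gⱼ* gⱼ`, `gⱼ ∈ M_n(L²)`, that lie in `M_n(L²)`. -/
def posCone (n : ℕ) : Set (Matrix (Fin n) (Fin n) (FloquetSpace d T)) :=
  {f | ∃ (m : ℕ) (g : Fin m → Matrix (Fin n) (Fin n) (FloquetSpace d T)),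
    ∀ᵐ t ∂(@AddCircle.haarAddCircle T _), blockMat (f.map fun h => h t) =
      ∑ j, (blockMat ((g j).map fun h => h t)).conjTranspose * blockMat ((g j).map fun h => h t)}

/-- The corresponding cone in `M_n(ℂ^{d×d} ⊗̄ L²(𝕋))`. -/
def tensorPosCone (n : ℕ) : Set (Matrix (Fin n) (Fin n) (FloquetTensor d T)) :=
  {f | f.map iota ∈ posCone n}

/-- Complete positivity on the Bochner space. -/
def IsCPBochner (A : FloquetSpace d T →L[ℂ] FloquetSpace d T) : Prop :=
  ∀ (n : ℕ), ∀ f ∈ posCone n, f.map A ∈ posCone n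

/-- Complete positivity on the tensor product. -/
def IsCPTensor (A : FloquetTensor d T →L[ℂ] FloquetTensor d T) : Prop :=
  ∀ (n : ℕ), ∀ f ∈ tensorPosCone n, f.map A ∈ tensorPosCone n

/-- The trace `(1/T) ∫ Tr f(t) dt` on the Bochner space. -/
noncomputable def bochnerTrace (f : FloquetSpace d T) : ℂ :=
  ∫ t, (TraceMat.mat (f t)).trace ∂(@AddCircle.haarAddCircle T _)

/-- The trace on the tensor product. -/
noncomputable def tensorTrace (f : FloquetTensor d T) : ℂ := bochnerTrace (iota f)

/-- Trace preservation on the Bochner space. -/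
def IsTPBochner (A : FloquetSpace d T →L[ℂ] FloquetSpace d T) : Prop :=
  ∀ f, bochnerTrace (A f) = bochnerTrace f

/-- Trace preservation on the tensor product. -/
def IsTPTensor (A : FloquetTensor d T →L[ℂ] FloquetTensor d T) : Prop :=
  ∀ f, tensorTrace (A f) = tensorTrace f

end Positivity

section Semigroups

variable {X : Type*} [NormedAddCommGroup X] [NormedSpace ℂ X]

/-- Contraction `C₀`-semigroups. -/
structure IsContractionSemigroup (W : ℝ≥0 → X →L[ℂ] X) : Prop where
  zero : W 0 = 1
  add : ∀ s t, W (s + t) = W s * W t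
  continuous : ∀ x, Continuous fun t => W t x
  contraction : ∀ t, ‖W t‖ ≤ 1

/-- The infinitesimal generator `x ↦ lim_{τ ↘ 0} τ⁻¹ (W_τ x - x)`, defined where the limit
exists. -/
noncomputable def generator (W : ℝ≥0 → X →L[ℂ] X) : X →ₗ.[ℂ] X where
  domain :=
    { carrier := {x | ∃ y, Tendsto (fun τ : ℝ≥0 => ((τ : ℝ) : ℂ)⁻¹ • (W τ x - x)) (𝓝[>] 0) (𝓝 y)}
      add_mem' := by
        rintro x x' ⟨y, hy⟩ ⟨y', hy'⟩
        refine ⟨y + y', (hy.add hy').congr fun τ => ?_⟩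
        rw [map_add, ← smul_add, add_sub_add_comm]
      zero_mem' := ⟨0, by simp⟩
      smul_mem' := by
        rintro c x ⟨y, hy⟩
        refine ⟨c • y, (hy.const_smul c).congr fun τ => ?_⟩
        rw [map_smul, ← smul_sub, smul_comm] }
  toFun :=
    { toFun := fun x => x.2.choose
      map_add' := fun x x' => by
        refine tendsto_nhds_unique (x + x').2.choose_spec
          ((x.2.choose_spec.add x'.2.choose_spec).congr fun τ => ?_)
        rw [Submodule.coe_add, map_add, ← smul_add, add_sub_add_comm]
      map_smul' := fun c x => by
        refine tendsto_nhds_unique (c • x).2.choose_spec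
          ((x.2.choose_spec.const_smul c).congr fun τ => ?_)
        rw [Submodule.coe_smul, map_smul, ← smul_sub, smul_comm] }

/-- Strong differentiability: for `x` in the (dense) domain of the generator `G`, the orbit
`τ ↦ W_τ x` stays in that domain and is differentiable on `[0, ∞)` with derivative `G W_τ x`. -/
def IsStronglyDifferentiable (W : ℝ≥0 → X →L[ℂ] X) : Prop :=
  Dense ((generator W).domain : Set X) ∧
    ∀ (x : (generator W).domain) (τ : ℝ≥0), ∃ y : (generator W).domain, (y : X) = W τ x ∧
      HasDerivWithinAt (fun s : ℝ => W s.toNNReal x) (generator W y) (Set.Ici 0) τ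

/-- `W` is generated by the closure of the operator `A`. -/
def IsGeneratedByClosure (W : ℝ≥0 → X →L[ℂ] X) (A : X →ₗ.[ℂ] X) : Prop :=
  A.IsClosable ∧ generator W = A.closure

end Semigroups

/-- `W_τ(f)(t) = V_{t,t-τ}(f(t-τ))` for all `τ ≥ 0` and `f` in the Bochner space; elements of the
latter are read as `T`-periodic functions of `t ∈ ℝ`, up to null sets. -/
def IsHowlandFamily {d : ℕ} {T : ℝ} [Fact (0 < T)] (Lam : ℝ → TraceMat d →L[ℂ] TraceMat d)
    (W : ℝ≥0 → FloquetSpace d T →L[ℂ] FloquetSpace d T) : Prop :=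
  ∀ (τ : ℝ≥0) (f : FloquetSpace d T), ∀ᵐ t : ℝ,
    W τ f (t : AddCircle T) = propagator Lam t (t - τ) (f ((t - τ : ℝ) : AddCircle T))

end Howland

open Howland

namespace Howland

/-! ### Generators of contraction semigroups -/

section Semigroups

variable {X : Type*} [NormedAddCommGroup X] [NormedSpace ℂ X]

/-! The operator `W_τ` is translation by `τ` on the circle followed by multiplication by the family
`V_{t,t-τ}`. The cocycle law of the propagator gives the semigroup law, and its invariance under a
common shift of both times by the period lets the family live on the circle.

Complete positivity of `V_{t,s}` is an invariance statement for the cone of positive semidefinite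
block matrices. At a boundary point of that cone with kernel vector `v`, the commutator and
anticommutator terms of the standard form vanish on `v`, and only the nonnegative terms with `V_k ρ
V_k*` survive (`reForm_nonneg_of_isStandardForm`). A small exponentially growing multiple of the
identity makes the inward derivative strict, so that the cone is never left
(`posSemidef_of_deriv_pos_on_boundary`, `isCP_propagator`). A completely positive, trace preserving
map contracts the trace norm (`norm_le_one_of_isCP_of_isTP`), and this makes `W_τ` a contraction of
the Bochner space. Positivity on that space is almost everywhere pointwise positivity, via a
continuous matrix square root (`mem_posCone_iff`).

The generator is found by perturbation. The quotients `τ⁻¹ (V_{t,t-τ} - 1)` tend to `L_t` uniformly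
in `t`, so `τ⁻¹ (W_τ f - f)` and the same quotient for the pure translations differ by a quantity
tending to `L f` for every `f`. Hence the two generators have the same domain and differ by the
bounded operator `L` (`mem_graph_generator_evolution`).

The translation generator is diagonal in Fourier space: it multiplies the `n`-th coefficient by
`-inΩ`. Fourier series converge unconditionally in the Bochner space, because the matrix factor is
finite dimensional. Therefore the Fourier partial sums of an element of the domain, which are
trigonometric polynomials and so `C¹`, converge to it in the graph norm; this gives the closure
statement. Conversely, generators of contraction semigroups are closed, so convergence of `∑ n fₙ
eₙ` forces `f` into the domain; this identifies the lifted generator on the whole domain of `I ⊗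
F_z`. -/

theorem mem_graph_generator {W : ℝ≥0 → X →L[ℂ] X} {x y : X} :
    (x, y) ∈ (generator W).graph ↔
      Tendsto (fun τ : ℝ≥0 => ((τ : ℝ) : ℂ)⁻¹ • (W τ x - x)) (𝓝[>] 0) (𝓝 y) := by
  rw [LinearPMap.mem_graph_iff]
  constructor
  · rintro ⟨z, hz, rfl⟩
    change (z : X) = x at hz
    subst hz
    exact z.2.choose_spec
  · intro h
    have hx : x ∈ (generator W).domain := ⟨y, h⟩
    exact ⟨⟨x, hx⟩, rfl, tendsto_nhds_unique (Exists.choose_spec hx) h⟩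

namespace IsContractionSemigroup

variable {W : ℝ≥0 → X →L[ℂ] X}

theorem norm_apply_le (hW : IsContractionSemigroup W) (t : ℝ≥0) (x : X) : ‖W t x‖ ≤ ‖x‖ :=
  ((W t).le_opNorm x).trans (mul_le_of_le_one_left (norm_nonneg x) (hW.contraction t))

theorem add_apply (hW : IsContractionSemigroup W) (s t : ℝ≥0) (x : X) :
    W (s + t) x = W s (W t x) := by
  rw [hW.add]; rfl

theorem continuous_orbit (hW : IsContractionSemigroup W) (x : X) :
    Continuous fun s : ℝ => W s.toNNReal x :=
  (hW.continuous x).comp continuous_real_toNNReal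

/-- For `r > s`, `W_r = W_s W_{r-s}`, and the bounded operator `W_s` passes through the limit
defining the generator. Only the right derivative comes out this way; the integral equation below
supplies the left one. -/
theorem hasDerivWithinAt_orbit_Ioi (hW : IsContractionSemigroup W) {x y : X}
    (h : (x, y) ∈ (generator W).graph) {s : ℝ} (hs : 0 ≤ s) :
    HasDerivWithinAt (fun r : ℝ => W r.toNNReal x) (W s.toNNReal y) (Set.Ioi s) s := by
  rw [mem_graph_generator] at h
  rw [hasDerivWithinAt_iff_tendsto_slope' (by simp)]
  have h1 : Tendsto (fun r : ℝ => (r - s).toNNReal) (𝓝[>] s) (𝓝[>] 0) := by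
    refine tendsto_nhdsWithin_iff.2 ⟨?_, ?_⟩
    · have : Continuous fun r : ℝ => (r - s).toNNReal := by fun_prop
      simpa using (this.tendsto s).mono_left nhdsWithin_le_nhds
    · filter_upwards [self_mem_nhdsWithin] with r hr
      simpa using hr
  refine (((W s.toNNReal).continuous.tendsto y).comp (h.comp h1)).congr' ?_
  filter_upwards [self_mem_nhdsWithin] with r hr
  have hr' : s < r := hr
  have h2 : r.toNNReal = s.toNNReal + (r - s).toNNReal := by
    rw [← Real.toNNReal_add hs (sub_nonneg.2 hr'.le)]; congr 1; ring
  simp only [Function.comp, slope, vsub_eq_sub]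
  rw [map_smul, map_sub, h2, hW.add_apply, Real.coe_toNNReal _ (sub_nonneg.2 hr'.le),
    ← Complex.ofReal_inv, Complex.coe_smul]

/-- The fundamental theorem of calculus for right derivatives in one direction, differentiation of
the integral at `0` in the other. This form has no limit in `τ`: for each `s` it is a closed
condition on `(x, y)`, which yields closedness of the generator without resolvents. -/
theorem mem_graph_generator_iff [CompleteSpace X] (hW : IsContractionSemigroup W) {x y : X} :
    (x, y) ∈ (generator W).graph ↔
      ∀ s : ℝ, 0 ≤ s → W s.toNNReal x - x = ∫ r in (0 : ℝ)..s, W r.toNNReal y := by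
  constructor
  · intro h s hs
    rw [intervalIntegral.integral_eq_sub_of_hasDeriv_right_of_le (f := fun r : ℝ => W r.toNNReal x)
      hs (hW.continuous_orbit x).continuousOn
      (fun r hr => hW.hasDerivWithinAt_orbit_Ioi h hr.1.le)
      ((hW.continuous_orbit y).intervalIntegrable _ _)]
    simp [hW.zero]
  · intro h
    rw [mem_graph_generator]
    have h1 : HasDerivAt (fun s : ℝ => ∫ r in (0 : ℝ)..s, W r.toNNReal y) y 0 := by
      simpa [hW.zero] using
        ((hW.continuous_orbit y).integral_hasStrictDerivAt 0 0).hasDerivAt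
    have h2 := (hasDerivWithinAt_iff_tendsto_slope' (by simp)).1
      (h1.hasDerivWithinAt (s := Set.Ioi 0))
    have h3 : Tendsto (fun τ : ℝ≥0 => (τ : ℝ)) (𝓝[>] 0) (𝓝[>] 0) := by
      refine tendsto_nhdsWithin_iff.2 ⟨?_, ?_⟩
      · exact (NNReal.continuous_coe.tendsto' 0 0 rfl).mono_left nhdsWithin_le_nhds
      · filter_upwards [self_mem_nhdsWithin] with r hr
        exact hr
    refine (h2.comp h3).congr fun τ => ?_
    simp only [Function.comp, slope, vsub_eq_sub, sub_zero, intervalIntegral.integral_same]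
    rw [← h τ τ.2, Real.toNNReal_coe, ← Complex.ofReal_inv, Complex.coe_smul]

theorem continuous_integral_orbit (hW : IsContractionSemigroup W) (s : ℝ) :
    Continuous fun y : X => ∫ r in (0 : ℝ)..s, W r.toNNReal y := by
  refine (LipschitzWith.of_dist_le_mul (K := |s|.toNNReal) fun y y' => ?_).continuous
  rw [dist_eq_norm, dist_eq_norm, ← intervalIntegral.integral_sub
    ((hW.continuous_orbit y).intervalIntegrable _ _)
    ((hW.continuous_orbit y').intervalIntegrable _ _), Real.coe_toNNReal _ (abs_nonneg s), mul_comm]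
  have := intervalIntegral.norm_integral_le_of_norm_le_const (a := 0) (b := s)
    (f := fun r : ℝ => W r.toNNReal y - W r.toNNReal y') (C := ‖y - y'‖) fun r _ => by
      rw [← map_sub]; exact hW.norm_apply_le _ _
  simpa using this

theorem isClosed_generator [CompleteSpace X] (hW : IsContractionSemigroup W) :
    (generator W).IsClosed := by
  have : ((generator W).graph : Set (X × X)) = ⋂ (s : ℝ) (_ : 0 ≤ s),
      {p | W s.toNNReal p.1 - p.1 = ∫ r in (0 : ℝ)..s, W r.toNNReal p.2} := by
    ext ⟨x, y⟩
    simp only [SetLike.mem_coe, hW.mem_graph_generator_iff, Set.mem_iInter, Set.mem_ofPred_eq]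
  rw [LinearPMap.IsClosed, this]
  refine isClosed_iInter fun s => isClosed_iInter fun _ => isClosed_eq (by fun_prop) ?_
  exact (hW.continuous_integral_orbit s).comp continuous_snd

theorem apply_mem_graph_generator (hW : IsContractionSemigroup W) {x y : X}
    (h : (x, y) ∈ (generator W).graph) (t : ℝ≥0) : (W t x, W t y) ∈ (generator W).graph := by
  rw [mem_graph_generator] at *
  refine (((W t).continuous.tendsto y).comp h).congr fun τ => ?_
  simp only [Function.comp]
  rw [map_smul, map_sub, ← hW.add_apply, ← hW.add_apply, add_comm]

theorem isStronglyDifferentiable [CompleteSpace X] (hW : IsContractionSemigroup W)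
    (hd : Dense ((generator W).domain : Set X)) : IsStronglyDifferentiable W := by
  refine ⟨hd, fun x τ => ?_⟩
  have hx := (generator W).mem_graph x
  obtain ⟨y, hy, hy'⟩ := (LinearPMap.mem_graph_iff _).1 (hW.apply_mem_graph_generator hx τ)
  refine ⟨y, hy, ?_⟩
  rw [hy']
  set z := generator W x
  -- The integral is differentiable from both sides even at `τ = 0`, since `Real.toNNReal` extends
  -- the integrand continuously to negative times. It agrees with the orbit on `[0, ∞)`.
  have h1 : HasDerivAt (fun s : ℝ => (x : X) + ∫ r in (0 : ℝ)..s, W r.toNNReal z) (W τ z) τ := by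
    simpa using (((hW.continuous_orbit z).integral_hasStrictDerivAt 0 τ).hasDerivAt).const_add
      (x : X)
  refine h1.hasDerivWithinAt.congr (fun s hs => ?_) ?_
  · rw [← hW.mem_graph_generator_iff.1 hx s hs]; abel
  · rw [← hW.mem_graph_generator_iff.1 hx τ τ.2]; abel

end IsContractionSemigroup

/-- A closed operator extending `A` whose graph lies in the closure of the graph of `A` is the
closure of `A`. -/
theorem closable_and_eq_closure {A B : X →ₗ.[ℂ] X} (hB : B.IsClosed) (hAB : A ≤ B)
    (h : (B.graph : Set (X × X)) ⊆ closure A.graph) : A.IsClosable ∧ B = A.closure := by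
  have hA : A.IsClosable := hB.isClosable.leIsClosable hAB
  refine ⟨hA, LinearPMap.eq_of_eq_graph ?_⟩
  rw [← hA.graph_closure_eq_closure_graph]
  refine le_antisymm (fun p hp => h hp) ?_
  exact Submodule.topologicalClosure_minimal _ (LinearPMap.le_graph_of_le hAB) hB

end Semigroups

end Howland

namespace Howland

/-! ### The propagator of a periodic linear equation -/

section Propagator

variable {d : ℕ} {T : ℝ} [Fact (0 < T)] {L : C(AddCircle T, TraceMat d →L[ℂ] TraceMat d)}
  {Lam : ℝ → TraceMat d →L[ℂ] TraceMat d}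

theorem norm_coeff_le (L : C(AddCircle T, TraceMat d →L[ℂ] TraceMat d)) (t : AddCircle T) :
    ‖L t‖ ≤ ‖L‖ :=
  L.norm_coe_le_norm t

theorem linearODE_unique {f g : ℝ → TraceMat d} {t₀ : ℝ}
    (hf : ∀ t : ℝ, HasDerivAt f (L (t : AddCircle T) (f t)) t)
    (hg : ∀ t : ℝ, HasDerivAt g (L (t : AddCircle T) (g t)) t) (h : f t₀ = g t₀) : f = g := by
  refine ODE_solution_unique_univ (v := fun t x => L (t : AddCircle T) x) (K := ‖L‖₊)
    (s := fun _ => Set.univ) (fun t => ?_) (fun t => ⟨hf t, trivial⟩) (fun t => ⟨hg t, trivial⟩) h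
  exact ((L (t : AddCircle T)).lipschitz.weaken (norm_coeff_le L t)).lipschitzOnWith

theorem linearODE_unique_clm {f g : ℝ → TraceMat d →L[ℂ] TraceMat d} {t₀ : ℝ}
    (hf : ∀ t : ℝ, HasDerivAt f (L (t : AddCircle T) * f t) t)
    (hg : ∀ t : ℝ, HasDerivAt g (L (t : AddCircle T) * g t) t) (h : f t₀ = g t₀) : f = g := by
  ext t x
  have key : ∀ f : ℝ → TraceMat d →L[ℂ] TraceMat d,
      (∀ t : ℝ, HasDerivAt f (L (t : AddCircle T) * f t) t) →
      ∀ t : ℝ, HasDerivAt (fun t => f t x) (L (t : AddCircle T) (f t x)) t := fun f hf t =>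
    ((ContinuousLinearMap.apply ℂ (TraceMat d) x).restrictScalars ℝ).hasFDerivAt.comp_hasDerivAt
      t (hf t)
  exact congrFun (linearODE_unique (key f hf) (key g hg) (by rw [h])) t

section

variable (hLam : ∀ t : ℝ, HasDerivAt Lam (L (t : AddCircle T) * Lam t) t) (hLam0 : Lam 0 = 1)

include hLam hLam0

/-- If `Λ_t x = 0`, then `s ↦ Λ_s x` solves the equation and vanishes at `t`, hence everywhere, in
particular at `0`, where it equals `x`. Finite dimension turns injectivity into bijectivity, so
`Ring.inverse` in the propagator is a genuine inverse. -/
theorem isUnit_evolution (t : ℝ) : IsUnit (Lam t) := by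
  rw [ContinuousLinearMap.isUnit_iff_bijective]
  have hinj : Function.Injective (Lam t) := by
    rw [injective_iff_map_eq_zero]
    intro x hx
    have h1 : ∀ s : ℝ, HasDerivAt (fun s => Lam s x) (L (s : AddCircle T) (Lam s x)) s := fun s =>
      ((ContinuousLinearMap.apply ℂ (TraceMat d) x).restrictScalars ℝ).hasFDerivAt.comp_hasDerivAt
        s (hLam s)
    have h2 := linearODE_unique (g := fun _ => 0) (t₀ := t) h1
      (fun s => by simpa using hasDerivAt_const s (0 : TraceMat d)) hx
    have h3 := congrFun h2 0
    simpa [hLam0] using h3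
  exact ⟨hinj, LinearMap.injective_iff_surjective (f := (Lam t).toLinearMap).1 hinj⟩

theorem propagator_self (t : ℝ) : propagator Lam t t = 1 :=
  Ring.mul_inverse_cancel _ (isUnit_evolution hLam hLam0 t)

theorem propagator_mul (t s r : ℝ) :
    propagator Lam t s * propagator Lam s r = propagator Lam t r := by
  rw [propagator, propagator, propagator, mul_assoc, ← mul_assoc (Ring.inverse (Lam s)),
    Ring.inverse_mul_cancel _ (isUnit_evolution hLam hLam0 s), one_mul]

theorem hasDerivAt_propagator (t s : ℝ) :
    HasDerivAt (fun t => propagator Lam t s) (L (t : AddCircle T) * propagator Lam t s) t := by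
  rw [propagator, ← mul_assoc]
  exact (hLam t).mul_const _

theorem continuous_propagator : Continuous fun p : ℝ × ℝ => propagator Lam p.1 p.2 := by
  have h1 : Continuous Lam := continuous_iff_continuousAt.2 fun t => (hLam t).continuousAt
  have h2 : Continuous fun t => Ring.inverse (Lam t) := continuous_iff_continuousAt.2 fun t => by
    obtain ⟨u, hu⟩ := isUnit_evolution hLam hLam0 t
    have := NormedRing.inverse_continuousAt u
    rw [hu] at this
    exact this.comp h1.continuousAt
  exact (h1.comp continuous_fst).mul (h2.comp continuous_snd)

/-- As functions of `t` both sides solve the same equation, because `L` is periodic, and both equal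
`1` at `t = s`. -/
theorem propagator_add_period (t s : ℝ) :
    propagator Lam (t + T) (s + T) = propagator Lam t s := by
  have h : (fun t => propagator Lam (t + T) (s + T)) = fun t => propagator Lam t s := by
    refine linearODE_unique_clm (L := L) (t₀ := s) (fun t => ?_)
      (fun t => hasDerivAt_propagator hLam hLam0 t s) ?_
    · have := (hasDerivAt_propagator hLam hLam0 (t + T) (s + T)).comp_add_const t T
      rwa [AddCircle.coe_add_period] at this
    · rw [propagator_self hLam hLam0, propagator_self hLam hLam0]
  exact congrFun h t

end

end Propagator

end Howland

namespace Howland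

/-! ### Quadratic forms and invariance of the positive semidefinite cone -/

section QuadraticForm

open Matrix

variable {N : Type*} [Fintype N]

/-- The real part of the quadratic form of a matrix. -/
noncomputable def reForm (Y : Matrix N N ℂ) (v : N → ℂ) : ℝ := (star v ⬝ᵥ (Y *ᵥ v)).re

theorem reForm_add (X Y : Matrix N N ℂ) (v : N → ℂ) :
    reForm (X + Y) v = reForm X v + reForm Y v := by
  simp [reForm, add_mulVec, dotProduct_add]

theorem reForm_smul (r : ℝ) (Y : Matrix N N ℂ) (v : N → ℂ) :
    reForm ((r : ℂ) • Y) v = r * reForm Y v := by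
  simp [reForm, smul_mulVec, dotProduct_smul]

theorem reForm_smul_right (c : ℂ) (Y : Matrix N N ℂ) (v : N → ℂ) :
    reForm Y (c • v) = ‖c‖ ^ 2 * reForm Y v := by
  have h : star (c • v) ⬝ᵥ (Y *ᵥ (c • v)) = ((‖c‖ ^ 2 : ℝ) : ℂ) * (star v ⬝ᵥ (Y *ᵥ v)) := by
    rw [star_smul, mulVec_smul, smul_dotProduct, dotProduct_smul, smul_eq_mul, smul_eq_mul,
      ← mul_assoc, Complex.star_def, Complex.conj_mul']
    push_cast; rfl
  rw [reForm, h, Complex.re_ofReal_mul, reForm]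

theorem reForm_one [DecidableEq N] (v : N → ℂ) :
    reForm (1 : Matrix N N ℂ) v = ∑ i, ‖v i‖ ^ 2 := by
  simp only [reForm, one_mulVec, dotProduct, Pi.star_apply, Complex.re_sum, Complex.star_def,
    Complex.conj_mul', ← Complex.ofReal_pow, Complex.ofReal_re]

/-- The norm on `N → ℂ` is the supremum norm, so some coordinate has modulus at least `1`; in
general there is no equality. -/
theorem one_le_reForm_one [DecidableEq N] {v : N → ℂ} (hv : ‖v‖ = 1) :
    1 ≤ reForm (1 : Matrix N N ℂ) v := by
  rw [reForm_one]
  obtain ⟨i, hi⟩ : ∃ i, 1 ≤ ‖v i‖ := by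
    by_contra! h
    exact absurd hv ((pi_norm_lt_iff one_pos).2 h).ne
  refine le_trans ?_ (Finset.single_le_sum (f := fun i => ‖v i‖ ^ 2) (fun _ _ => sq_nonneg _)
    (Finset.mem_univ i))
  exact one_le_pow₀ hi

theorem continuous_reForm : Continuous fun p : Matrix N N ℂ × (N → ℂ) => reForm p.1 p.2 := by
  unfold reForm
  fun_prop

theorem posSemidef_iff_reForm_nonneg {Y : Matrix N N ℂ} (hY : Y.IsHermitian) :
    Y.PosSemidef ↔ ∀ v, 0 ≤ reForm Y v := by
  constructor
  · intro h v
    exact (Complex.nonneg_iff.1 (h.dotProduct_mulVec_nonneg v)).1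
  · intro h
    refine PosSemidef.of_dotProduct_mulVec_nonneg hY fun v => Complex.nonneg_iff.2 ⟨h v, ?_⟩
    have := hY.im_star_dotProduct_mulVec_self v
    exact this.symm

theorem reForm_pos_of_sphere {Y : Matrix N N ℂ} (h : ∀ v, ‖v‖ = 1 → 0 < reForm Y v) {v : N → ℂ}
    (hv : v ≠ 0) : 0 < reForm Y v := by
  have h1 : 0 < ‖v‖ := norm_pos_iff.2 hv
  have h2 := h ((‖v‖⁻¹ : ℂ) • v) (by
    rw [norm_smul, norm_inv, Complex.norm_real, norm_norm, inv_mul_cancel₀ h1.ne'])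
  rw [reForm_smul_right] at h2
  exact pos_of_mul_pos_right h2 (sq_nonneg _)

/-- A continuous family of Hermitian matrices which starts positive definite stays positive
semidefinite if its derivative is positive in the kernel directions at the boundary of the cone. -/
theorem posSemidef_of_deriv_pos_on_boundary {Y : ℝ → Matrix N N ℂ} {D : ℝ → (N → ℂ) → ℝ}
    {s : ℝ} (hc : Continuous Y) (hH : ∀ t, (Y t).IsHermitian)
    (h0 : ∀ v, ‖v‖ = 1 → 0 < reForm (Y s) v)
    (hD : ∀ t v, HasDerivAt (fun t => reForm (Y t) v) (D t v) t)
    (hpos : ∀ t v, (Y t).PosSemidef → ‖v‖ = 1 → reForm (Y t) v = 0 → 0 < D t v)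
    {t : ℝ} (ht : s ≤ t) : (Y t).PosSemidef := by
  suffices H : ∀ v, ‖v‖ = 1 → 0 < reForm (Y t) v by
    rw [posSemidef_iff_reForm_nonneg (hH t)]
    intro v
    by_cases hv : v = 0
    · simp [hv, reForm]
    · exact (reForm_pos_of_sphere H hv).le
  by_contra! hcon
  have hcF : Continuous fun p : ℝ × (N → ℂ) => reForm (Y p.1) p.2 :=
    continuous_reForm.comp ((hc.comp continuous_fst).prodMk continuous_snd)
  -- By compactness there is a first time `t₀` at which the form is nonpositive on some unit vector
  -- `v`. Before `t₀` the form is positive, so `Y t₀` is positive semidefinite by passing to the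
  -- left limit, and the form vanishes at `v`. A positive derivative there would make the form
  -- negative just before `t₀`.
  set K : Set (ℝ × (N → ℂ)) := (Set.Icc s t ×ˢ Metric.sphere 0 1) ∩ {p | reForm (Y p.1) p.2 ≤ 0}
    with hK
  have hKc : IsCompact K := (isCompact_Icc.prod (isCompact_sphere _ _)).inter_right
    (isClosed_le hcF continuous_const)
  obtain ⟨v₁, hv₁, hv₁'⟩ := hcon
  have hKn : (Prod.fst '' K).Nonempty :=
    ⟨t, (t, v₁), ⟨⟨⟨ht, le_rfl⟩, by simpa using hv₁⟩, hv₁'⟩, rfl⟩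
  obtain ⟨t₀, ⟨⟨_, v⟩, ⟨⟨⟨hst, htt⟩, hv⟩, hle⟩, rfl⟩, hmin⟩ :=
    (hKc.image continuous_fst).exists_isLeast hKn
  simp only at hst htt hle hmin
  rename_i t₀
  replace hv : ‖v‖ = 1 := by simpa using hv
  replace hle : reForm (Y t₀) v ≤ 0 := hle
  have hs : s < t₀ := lt_of_le_of_ne hst fun h => by
    subst h
    exact absurd (h0 v hv) (not_lt.2 hle)
  have hbefore : ∀ r ∈ Set.Ico s t₀, ∀ w, ‖w‖ = 1 → 0 < reForm (Y r) w := by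
    intro r hr w hw
    by_contra! hcon
    exact absurd (hmin ⟨(r, w), ⟨⟨⟨hr.1, hr.2.le.trans htt⟩, by simpa using hw⟩, hcon⟩, rfl⟩)
      (not_le.2 hr.2)
  have hev : ∀ᶠ r in 𝓝[<] t₀, r ∈ Set.Ico s t₀ := Ico_mem_nhdsLT hs
  have hpsd : (Y t₀).PosSemidef := by
    rw [posSemidef_iff_reForm_nonneg (hH t₀)]
    intro w
    by_cases hw : w = 0
    · simp [hw, reForm]
    have hlim : Tendsto (fun r => reForm (Y r) w) (𝓝[<] t₀) (𝓝 (reForm (Y t₀) w)) :=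
      ((hD t₀ w).continuousAt.tendsto).mono_left nhdsWithin_le_nhds
    refine ge_of_tendsto hlim (hev.mono fun r hr => ?_)
    exact (reForm_pos_of_sphere (hbefore r hr) hw).le
  have hzero : reForm (Y t₀) v = 0 := le_antisymm hle ((posSemidef_iff_reForm_nonneg (hH t₀)).1 hpsd v)
  have hd := hpos t₀ v hpsd hv hzero
  have hsl := (hasDerivAt_iff_tendsto_slope.1 (hD t₀ v)).mono_left
    (nhdsWithin_mono t₀ (fun x hx => ne_of_lt hx : Set.Iio t₀ ⊆ {t₀}ᶜ))
  obtain ⟨r, hr1, hr2⟩ := ((hsl.eventually (lt_mem_nhds hd)).and hev).exists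
  rw [slope_def_field, hzero, sub_zero] at hr1
  exact absurd hr1 (not_lt.2 (div_nonpos_of_nonneg_of_nonpos (hbefore r hr2 v hv).le
    (sub_nonpos.2 hr2.2.le)))

end QuadraticForm

end Howland

namespace Howland

/-! ### Algebra of the standard form -/

section Lindblad

open Matrix
open scoped Kronecker

variable {d n : ℕ}

theorem blockMat_add (B C : Matrix (Fin n) (Fin n) (TraceMat d)) :
    blockMat (B + C) = blockMat B + blockMat C := by
  ext p q; simp [blockMat]

theorem blockMat_smul (c : ℂ) (B : Matrix (Fin n) (Fin n) (TraceMat d)) :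
    blockMat (c • B) = c • blockMat B := by
  ext p q; simp [blockMat]

theorem blockMat_one :
    blockMat (Matrix.of fun i j : Fin n => if i = j then TraceMat.mat.symm
      (1 : Matrix (Fin d) (Fin d) ℂ) else 0) = 1 := by
  ext ⟨i, a⟩ ⟨j, b⟩
  by_cases h : i = j <;> simp [blockMat, h, Matrix.one_apply]

theorem blockMat_isHermitian_iff {B : Matrix (Fin n) (Fin n) (TraceMat d)} :
    (blockMat B).IsHermitian ↔
      ∀ i j, (TraceMat.mat (B i j))ᴴ = TraceMat.mat (B j i) := by
  constructor
  · intro h i j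
    ext a b
    have := congrFun (congrFun h (j, a)) (i, b)
    simpa [blockMat] using this
  · intro h
    ext ⟨i, a⟩ ⟨j, b⟩
    have := congrFun (congrFun (h j i) a) b
    simpa [blockMat] using this

/-- The entrywise action of `a ↦ M a` on a block matrix is multiplication by `1 ⊗ M`. With the two
variants below, the amplification of a standard form is again of standard form. -/
theorem kronecker_mul_blockMat (M : Matrix (Fin d) (Fin d) ℂ)
    (B : Matrix (Fin n) (Fin n) (TraceMat d)) (p q : Fin n × Fin d) :
    ((1 : Matrix (Fin n) (Fin n) ℂ) ⊗ₖ M * blockMat B) p q =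
      (M * TraceMat.mat (B p.1 q.1)) p.2 q.2 := by
  simp [Matrix.mul_apply, Fintype.sum_prod_type, Matrix.one_apply, blockMat, ite_mul]

theorem blockMat_mul_kronecker (M : Matrix (Fin d) (Fin d) ℂ)
    (B : Matrix (Fin n) (Fin n) (TraceMat d)) (p q : Fin n × Fin d) :
    (blockMat B * (1 : Matrix (Fin n) (Fin n) ℂ) ⊗ₖ M) p q =
      (TraceMat.mat (B p.1 q.1) * M) p.2 q.2 := by
  simp [Matrix.mul_apply, Fintype.sum_prod_type, Matrix.one_apply, blockMat, mul_ite]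

theorem kronecker_mul_blockMat_mul_kronecker (M M' : Matrix (Fin d) (Fin d) ℂ)
    (B : Matrix (Fin n) (Fin n) (TraceMat d)) (p q : Fin n × Fin d) :
    ((1 : Matrix (Fin n) (Fin n) ℂ) ⊗ₖ M * blockMat B * (1 : Matrix (Fin n) (Fin n) ℂ) ⊗ₖ M') p q =
      (M * TraceMat.mat (B p.1 q.1) * M') p.2 q.2 := by
  have h : (1 : Matrix (Fin n) (Fin n) ℂ) ⊗ₖ M * blockMat B =
      blockMat (B.map fun a => TraceMat.mat.symm (M * TraceMat.mat a)) := by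
    ext p q
    rw [kronecker_mul_blockMat]
    simp [blockMat]
  rw [h, blockMat_mul_kronecker]
  simp

/-- For a positive semidefinite matrix, a zero of the quadratic form is a kernel vector, on the
right and, after taking adjoints, on the left. Every term with the block matrix at an outer end then
vanishes, and what remains is a sum of congruences `K B K*`. -/
theorem reForm_nonneg_of_isStandardForm {A : TraceMat d →L[ℂ] TraceMat d} (hA : IsStandardForm A)
    {B : Matrix (Fin n) (Fin n) (TraceMat d)} (hB : (blockMat B).PosSemidef)
    {v : Fin n × Fin d → ℂ} (hv : reForm (blockMat B) v = 0) :
    0 ≤ reForm (blockMat (B.map A)) v := by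
  obtain ⟨H, r, V, -, hA⟩ := hA
  have h0 : star v ⬝ᵥ (blockMat B *ᵥ v) = 0 :=
    Complex.ext hv (hB.isHermitian.im_star_dotProduct_mulVec_self v)
  have h1 : blockMat B *ᵥ v = 0 := (hB.dotProduct_mulVec_zero_iff v).1 h0
  have h2 : star v ᵥ* blockMat B = 0 := by
    rw [← hB.isHermitian.eq, ← star_mulVec, h1, star_zero]
  have hl : ∀ M : Matrix (Fin n × Fin d) (Fin n × Fin d) ℂ,
      star v ⬝ᵥ ((M * blockMat B) *ᵥ v) = 0 := fun M => by
    rw [← mulVec_mulVec, h1, mulVec_zero, dotProduct_zero]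
  have hr : ∀ M : Matrix (Fin n × Fin d) (Fin n × Fin d) ℂ,
      star v ⬝ᵥ ((blockMat B * M) *ᵥ v) = 0 := fun M => by
    rw [← mulVec_mulVec, dotProduct_mulVec, h2, zero_dotProduct]
  let K : Matrix (Fin d) (Fin d) ℂ → Matrix (Fin n × Fin d) (Fin n × Fin d) ℂ :=
    fun M => (1 : Matrix (Fin n) (Fin n) ℂ) ⊗ₖ M
  have hK : ∀ k, (K (V k))ᴴ = K (V k)ᴴ := fun k => by
    simp only [K, conjTranspose_kronecker, conjTranspose_one]
  have hform : blockMat (B.map A) = (-Complex.I) • (K H * blockMat B - blockMat B * K H) +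
      ∑ k, (K (V k) * blockMat B * (K (V k))ᴴ - (1 / 2 : ℂ) • (K ((V k)ᴴ * V k) * blockMat B +
        blockMat B * K ((V k)ᴴ * V k))) := by
    ext p q
    simp only [hK, Matrix.add_apply, Matrix.smul_apply, Matrix.sub_apply, Matrix.sum_apply, K,
      kronecker_mul_blockMat_mul_kronecker, kronecker_mul_blockMat, blockMat_mul_kronecker]
    rw [blockMat, Matrix.of_apply, Matrix.map_apply, hA]
    simp only [Matrix.add_apply, Matrix.smul_apply, Matrix.sub_apply, Matrix.sum_apply]
  rw [reForm, hform]
  simp only [add_mulVec, smul_mulVec, sub_mulVec, dotProduct_add, dotProduct_smul, dotProduct_sub,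
    hl, hr, sum_mulVec, dotProduct_sum, sub_zero, add_zero, smul_zero, zero_add]
  rw [Complex.re_sum]
  exact Finset.sum_nonneg fun k _ => (Complex.nonneg_iff.1
    ((hB.mul_mul_conjTranspose_same (K (V k))).dotProduct_mulVec_nonneg v)).1

theorem trace_of_isStandardForm {A : TraceMat d →L[ℂ] TraceMat d} (hA : IsStandardForm A)
    (a : TraceMat d) : (TraceMat.mat (A a)).trace = 0 := by
  obtain ⟨H, r, V, -, hA⟩ := hA
  rw [hA]
  simp only [trace_add, trace_smul, trace_sub, trace_sum, trace_mul_comm H, sub_self, smul_zero,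
    zero_add]
  refine Finset.sum_eq_zero fun k _ => ?_
  rw [trace_mul_comm (V k * TraceMat.mat a), ← Matrix.mul_assoc,
    trace_mul_comm (TraceMat.mat a), smul_eq_mul]
  ring

theorem star_of_isStandardForm {A : TraceMat d →L[ℂ] TraceMat d} (hA : IsStandardForm A)
    (a : TraceMat d) :
    TraceMat.mat (A (TraceMat.mat.symm (TraceMat.mat a)ᴴ)) = (TraceMat.mat (A a))ᴴ := by
  obtain ⟨H, r, V, hH, hA⟩ := hA
  rw [hA, hA]
  simp only [LinearEquiv.apply_symm_apply, conjTranspose_add, conjTranspose_smul,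
    conjTranspose_sub, conjTranspose_mul, conjTranspose_sum, conjTranspose_conjTranspose, hH.eq,
    Matrix.mul_assoc]
  congr 1
  · rw [← neg_sub, smul_neg, ← neg_smul]; simp
  · refine Finset.sum_congr rfl fun k _ => ?_
    rw [add_comm]; simp

end Lindblad

/-! ### Complete positivity and trace preservation of the propagator -/

section PropagatorPositivity

open Matrix

variable {d : ℕ} {T : ℝ} [Fact (0 < T)] {L : C(AddCircle T, TraceMat d →L[ℂ] TraceMat d)}
  {Lam : ℝ → TraceMat d →L[ℂ] TraceMat d}

/-- The conjugate transpose, as a continuous real-linear map. -/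
noncomputable def adjointL : TraceMat d →L[ℝ] TraceMat d :=
  LinearMap.toContinuousLinearMap
    { toFun := fun a => TraceMat.mat.symm (TraceMat.mat a)ᴴ
      map_add' := fun a b => by simp
      map_smul' := fun r a => by
        rw [← Complex.coe_smul, map_smul, conjTranspose_smul, map_smul]
        simp }

theorem adjointL_apply (a : TraceMat d) : adjointL a = TraceMat.mat.symm (TraceMat.mat a)ᴴ := rfl

theorem continuous_mat : Continuous (TraceMat.mat : TraceMat d → Matrix (Fin d) (Fin d) ℂ) :=
  LinearMap.continuous_of_finiteDimensional TraceMat.mat.toLinearMap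

theorem continuous_blockMat {n : ℕ} :
    Continuous (blockMat : Matrix (Fin n) (Fin n) (TraceMat d) → _) := by
  refine continuous_pi fun p => continuous_pi fun q => ?_
  exact (continuous_apply q.2).comp ((continuous_apply p.2).comp
    (continuous_mat.comp ((continuous_apply q.1).comp (continuous_apply p.1))))

/-- `A ↦ A B` for a block matrix `B`, followed by the quadratic form at `v`. -/
noncomputable def blockFormL {n : ℕ} (B : Matrix (Fin n) (Fin n) (TraceMat d))
    (v : Fin n × Fin d → ℂ) : (TraceMat d →L[ℂ] TraceMat d) →L[ℝ] ℝ :=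
  LinearMap.toContinuousLinearMap
    { toFun := fun A => reForm (blockMat (B.map A)) v
      map_add' := fun A A' => by
        rw [← reForm_add, ← blockMat_add]; rfl
      map_smul' := fun r A => by
        rw [RingHom.id_apply, smul_eq_mul, ← reForm_smul, ← blockMat_smul]; rfl }

theorem blockFormL_apply {n : ℕ} (B : Matrix (Fin n) (Fin n) (TraceMat d))
    (v : Fin n × Fin d → ℂ) (A : TraceMat d →L[ℂ] TraceMat d) :
    blockFormL B v A = reForm (blockMat (B.map A)) v := rfl

section

variable (hL : ∀ t, IsStandardForm (L t))
  (hLam : ∀ t : ℝ, HasDerivAt Lam (L (t : AddCircle T) * Lam t) t) (hLam0 : Lam 0 = 1)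

include hL hLam hLam0

theorem isTP_propagator (t s : ℝ) : IsTP (propagator Lam t s) := by
  intro a
  let ℓ : (TraceMat d →L[ℂ] TraceMat d) →L[ℂ] ℂ := LinearMap.toContinuousLinearMap
    (traceLinearMap (Fin d) ℂ ℂ ∘ₗ TraceMat.mat.toLinearMap ∘ₗ
      (ContinuousLinearMap.apply ℂ (TraceMat d) a).toLinearMap)
  have hd : ∀ t : ℝ, HasDerivAt (fun t => ℓ (propagator Lam t s)) 0 t := fun t => by
    have h := (ℓ.restrictScalars ℝ).hasFDerivAt.comp_hasDerivAt t
      (hasDerivAt_propagator hLam hLam0 t s)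
    have h0 : ℓ (L (t : AddCircle T) * propagator Lam t s) = 0 := trace_of_isStandardForm (hL t) _
    exact h.congr_deriv h0
  have h := is_const_of_deriv_eq_zero (fun t => (hd t).differentiableAt) (fun t => (hd t).deriv) t s
  rw [propagator_self hLam hLam0] at h
  exact h

/-- The standard form commutes with the adjoint, so both sides solve the same equation from the same
initial value. This keeps block matrices Hermitian under the flow. -/
theorem propagator_adjoint (t s : ℝ) (a : TraceMat d) :
    propagator Lam t s (adjointL a) = adjointL (propagator Lam t s a) := by
  have key : ∀ b : TraceMat d, ∀ t : ℝ, HasDerivAt (fun t => propagator Lam t s b)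
      (L (t : AddCircle T) (propagator Lam t s b)) t := fun b t =>
    ((ContinuousLinearMap.apply ℂ (TraceMat d) b).restrictScalars ℝ).hasFDerivAt.comp_hasDerivAt
      t (hasDerivAt_propagator hLam hLam0 t s)
  refine congrFun (linearODE_unique (L := L) (t₀ := s) (key _)
    (g := fun t => adjointL (propagator Lam t s a)) (fun t => ?_)
    (by simp only [propagator_self hLam hLam0]; rfl)) t
  have h1 := adjointL.hasFDerivAt.comp_hasDerivAt t (key a t)
  have h2 : L (t : AddCircle T) (adjointL (propagator Lam t s a)) =
      adjointL (L (t : AddCircle T) (propagator Lam t s a)) :=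
    TraceMat.mat.injective (star_of_isStandardForm (hL t) _)
  rw [h2]
  exact h1

theorem isCP_propagator {s t : ℝ} (hst : s ≤ t) : IsCP (propagator Lam t s) := by
  intro n B hB
  set E : Matrix (Fin n) (Fin n) (TraceMat d) := Matrix.of fun i j => if i = j then
    TraceMat.mat.symm (1 : Matrix (Fin d) (Fin d) ℂ) else 0 with hE
  have hmap : ∀ (C : Matrix (Fin n) (Fin n) (TraceMat d)) {Y : Type} [TopologicalSpace Y]
      {f : Y → TraceMat d →L[ℂ] TraceMat d}, Continuous f →
      Continuous fun y => blockMat (C.map (f y)) := fun C Y _ f hf =>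
    continuous_blockMat.comp (continuous_pi fun i => continuous_pi fun j =>
      hf.clm_apply continuous_const)
  -- The growth rate `c` of the perturbation must beat the form of `L_t` applied to the identity
  -- block matrix `E`, uniformly over the compact set of times and unit vectors. Nonnegativity of
  -- `c` is wanted because the form of `1` at a unit vector is only known to be at least `1`.
  obtain ⟨c, hc0, hc⟩ : ∃ c : ℝ, 0 ≤ c ∧ ∀ (t : AddCircle T) (v : Fin n × Fin d → ℂ), ‖v‖ = 1 →
      reForm (blockMat (E.map (L t))) v < c := by
    have hF : Continuous fun p : AddCircle T × (Fin n × Fin d → ℂ) =>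
        reForm (blockMat (E.map (L p.1))) p.2 :=
      continuous_reForm.comp (((hmap E L.continuous).comp continuous_fst).prodMk continuous_snd)
    obtain ⟨c, hc⟩ := ((isCompact_univ (X := AddCircle T)).prod
      (isCompact_sphere (0 : Fin n × Fin d → ℂ) 1)).bddAbove_image hF.continuousOn
    refine ⟨max c 0 + 1, by positivity, fun t v hv => ?_⟩
    have := hc ⟨(t, v), ⟨trivial, by simpa using hv⟩, rfl⟩
    exact lt_of_le_of_lt (this.trans (le_max_left c 0)) (lt_add_one _)
  have hherm : ∀ r, (blockMat (B.map (propagator Lam r s))).IsHermitian := fun r => by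
    rw [blockMat_isHermitian_iff]
    intro i j
    have h1 := blockMat_isHermitian_iff.1 hB.isHermitian i j
    have h2 := congrArg TraceMat.mat (propagator_adjoint hL hLam hLam0 r s (B i j))
    rw [adjointL_apply, adjointL_apply, h1] at h2
    simpa using h2.symm
  have hcP : Continuous fun r => propagator Lam r s :=
    (continuous_propagator hLam hLam0).comp (continuous_id.prodMk continuous_const)
  have key : ∀ ε : ℝ, 0 < ε → ∀ v, 0 ≤ reForm (blockMat (B.map (propagator Lam t s)) +
      ((ε * Real.exp (c * (t - s)) : ℝ) : ℂ) • 1) v := by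
    intro ε hε
    set Y : ℝ → Matrix (Fin n × Fin d) (Fin n × Fin d) ℂ := fun r =>
      blockMat (B.map (propagator Lam r s)) + ((ε * Real.exp (c * (r - s)) : ℝ) : ℂ) • 1 with hY
    have hYH : ∀ r, (Y r).IsHermitian := fun r => by
      refine (hherm r).add ?_
      rw [IsHermitian, conjTranspose_smul, conjTranspose_one, Complex.star_def, Complex.conj_ofReal]
    have hYb : ∀ r, Y r = blockMat (B.map (propagator Lam r s) +
        ((ε * Real.exp (c * (r - s)) : ℝ) : ℂ) • E) := fun r => by
      rw [blockMat_add, blockMat_smul, hE, blockMat_one]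
    have hYc : Continuous Y := (hmap B hcP).add (by fun_prop)
    have hderiv : ∀ (r : ℝ) (v), HasDerivAt (fun r => reForm (Y r) v)
        (reForm (blockMat (B.map (L (r : AddCircle T) * propagator Lam r s))) v +
          ε * Real.exp (c * (r - s)) * c * reForm 1 v) r := by
      intro r v
      have h1 := (blockFormL B v).hasFDerivAt.comp_hasDerivAt r
        (hasDerivAt_propagator hLam hLam0 r s)
      have h2 : HasDerivAt (fun r => ε * Real.exp (c * (r - s)) * reForm 1 v)
          (ε * (Real.exp (c * (r - s)) * (c * 1)) * reForm (1 : Matrix (Fin n × Fin d) _ ℂ) v) r :=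
        ((((hasDerivAt_id r).sub_const s).const_mul c).exp.const_mul ε).mul_const _
      have h3 := h1.add h2
      refine (h3.congr_deriv ?_).congr_of_eventuallyEq (Eventually.of_forall fun r => ?_)
      · rw [blockFormL_apply]; ring
      · simp only [hY, reForm_add, reForm_smul]; rfl
    have := posSemidef_of_deriv_pos_on_boundary hYc hYH (fun v hv => ?_) hderiv
      (fun r v hpsd hv hzero => ?_) hst
    · exact (posSemidef_iff_reForm_nonneg (hYH t)).1 this
    · simp only [hY]
      rw [reForm_add, reForm_smul]
      have h1 : 0 ≤ reForm (blockMat (B.map (propagator Lam s s))) v := by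
        rw [propagator_self hLam hLam0]
        exact (posSemidef_iff_reForm_nonneg hB.isHermitian).1 hB v
      have h2 := one_le_reForm_one hv
      have h3 : 0 < ε * Real.exp (c * (s - s)) := by positivity
      nlinarith
    -- With `η = ε e^{c(r-s)}`, nonnegativity of the generator at the boundary bounds the form of
    -- `L_r V_{r,s} B` below by `-η` times the form of `L_r E`. The term `η c` from differentiating
    -- the exponential strictly exceeds this loss.
    · rw [hYb] at hpsd hzero
      have h1 := reForm_nonneg_of_isStandardForm (hL r) hpsd hzero
      have h2 : (B.map (propagator Lam r s) + ((ε * Real.exp (c * (r - s)) : ℝ) : ℂ) • E).map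
          (L (r : AddCircle T)) = B.map (L (r : AddCircle T) * propagator Lam r s) +
          ((ε * Real.exp (c * (r - s)) : ℝ) : ℂ) • E.map (L (r : AddCircle T)) := by
        ext1 i j
        simp
      rw [h2, blockMat_add, reForm_add, blockMat_smul, reForm_smul] at h1
      have h3 := hc r v hv
      have h4 := one_le_reForm_one hv
      have h5 : 0 < ε * Real.exp (c * (r - s)) := by positivity
      nlinarith [mul_nonneg hc0 (sub_nonneg.2 h4)]
  rw [posSemidef_iff_reForm_nonneg (hherm t)]
  intro v
  have hlim : Tendsto (fun ε : ℝ => reForm (blockMat (B.map (propagator Lam t s)) +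
      ((ε * Real.exp (c * (t - s)) : ℝ) : ℂ) • 1) v) (𝓝[>] 0)
      (𝓝 (reForm (blockMat (B.map (propagator Lam t s))) v)) := by
    simp only [reForm_add, reForm_smul]
    have : Continuous fun ε : ℝ => reForm (blockMat (B.map (propagator Lam t s))) v +
      ε * Real.exp (c * (t - s)) * reForm 1 v := by fun_prop
    exact (this.tendsto' 0 _ (by simp)).mono_left nhdsWithin_le_nhds
  exact ge_of_tendsto hlim (eventually_mem_nhdsWithin.mono fun ε hε => key ε hε v)

end

end PropagatorPositivity

end Howland

namespace Howland

/-! ### Completely positive, trace preserving maps contract the trace norm -/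

section TraceNormContraction

open Matrix

variable {d : ℕ}

/-- The rank one operator `x y*`. -/
noncomputable def rankOneMat (x y : EuclideanSpace ℂ (Fin d)) : TraceMat d :=
  TraceMat.mat.symm (vecMulVec x.ofLp (star y.ofLp))

theorem mat_rankOneMat (x y : EuclideanSpace ℂ (Fin d)) :
    TraceMat.mat (rankOneMat x y) = vecMulVec x.ofLp (star y.ofLp) := rfl

theorem rankOneMat_smul_left (c : ℂ) (x y : EuclideanSpace ℂ (Fin d)) :
    rankOneMat (c • x) y = c • rankOneMat x y := by
  apply TraceMat.mat.injective
  rw [map_smul, mat_rankOneMat, mat_rankOneMat, WithLp.ofLp_smul, smul_vecMulVec]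

theorem trace_rankOneMat_self (x : EuclideanSpace ℂ (Fin d)) :
    (TraceMat.mat (rankOneMat x x)).trace = ((‖x‖ ^ 2 : ℝ) : ℂ) := by
  rw [mat_rankOneMat, trace_vecMulVec, ← EuclideanSpace.inner_eq_star_dotProduct,
    inner_self_eq_norm_sq_to_K]
  simp

theorem eq_sum_rankOneMat (a : TraceMat d)
    (e : OrthonormalBasis (Fin d) ℂ (EuclideanSpace ℂ (Fin d))) :
    a = ∑ i, rankOneMat (toEuclideanLin (TraceMat.mat a) (e i)) (e i) := by
  apply TraceMat.mat.injective
  apply toEuclideanLin.injective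
  refine e.toBasis.ext fun j => ?_
  rw [map_sum, map_sum, LinearMap.sum_apply, e.coe_toBasis, Finset.sum_eq_single j]
  · apply WithLp.ofLp_injective 2
    have h : star (e j).ofLp ⬝ᵥ (e j).ofLp = 1 := by
      rw [dotProduct_comm, ← EuclideanSpace.inner_eq_star_dotProduct,
        orthonormal_iff_ite.1 e.orthonormal, if_pos rfl]
    rw [mat_rankOneMat]
    simp [vecMulVec_mulVec, h]
  · intro i _ hij
    apply WithLp.ofLp_injective 2
    have h : star (e i).ofLp ⬝ᵥ (e j).ofLp = 0 := by
      rw [dotProduct_comm, ← EuclideanSpace.inner_eq_star_dotProduct,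
        orthonormal_iff_ite.1 e.orthonormal, if_neg hij]
    rw [mat_rankOneMat]
    simp [vecMulVec_mulVec, h]
  · simp

theorem norm_adjoint_apply_le {C : EuclideanSpace ℂ (Fin d) →ₗ[ℂ] EuclideanSpace ℂ (Fin d)}
    (hC : ∀ x, ‖C x‖ ≤ ‖x‖) (x : EuclideanSpace ℂ (Fin d)) :
    ‖LinearMap.adjoint C x‖ ≤ ‖x‖ := by
  set y := LinearMap.adjoint C x
  have h : ‖y‖ * ‖y‖ ≤ ‖x‖ * ‖y‖ := by
    have h1 : ⟪y, y⟫_ℂ = ⟪x, C y⟫_ℂ := LinearMap.adjoint_inner_left _ _ _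
    calc ‖y‖ * ‖y‖ = ‖⟪y, y⟫_ℂ‖ := by
          rw [inner_self_eq_norm_sq_to_K]; simp [sq]
      _ = ‖⟪x, C y⟫_ℂ‖ := by rw [h1]
      _ ≤ ‖x‖ * ‖C y‖ := norm_inner_le_norm _ _
      _ ≤ ‖x‖ * ‖y‖ := by gcongr; exact hC y
  by_cases hy : ‖y‖ = 0
  · rw [hy]; exact norm_nonneg _
  · exact le_of_mul_le_mul_right h (lt_of_le_of_ne (norm_nonneg _) (Ne.symm hy))

/-- The sum is `Tr C* P C`. For `P = w w*` it equals `‖C* w‖²`, which is at most `‖w‖² = Tr P`; a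
general `P` is a sum of such matrices. -/
theorem sum_reForm_le_trace {P : Matrix (Fin d) (Fin d) ℂ} (hP : P.PosSemidef)
    {C : EuclideanSpace ℂ (Fin d) →ₗ[ℂ] EuclideanSpace ℂ (Fin d)} (hC : ∀ x, ‖C x‖ ≤ ‖x‖)
    (e : OrthonormalBasis (Fin d) ℂ (EuclideanSpace ℂ (Fin d))) :
    ∑ k, reForm P (C (e k)).ofLp ≤ P.trace.re := by
  obtain ⟨m, v, rfl⟩ := posSemidef_iff_eq_sum_vecMulVec.1 hP
  have h1 : ∀ (w : Fin d → ℂ) (x : EuclideanSpace ℂ (Fin d)),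
      reForm (vecMulVec w (star w)) x.ofLp = ‖⟪WithLp.toLp 2 w, x⟫_ℂ‖ ^ 2 := fun w x => by
    rw [reForm, vecMulVec_mulVec, dotProduct_smul, EuclideanSpace.inner_eq_star_dotProduct,
      op_smul_eq_smul, smul_eq_mul, dotProduct_comm (star x.ofLp), dotProduct_comm (star w)]
    have : w ⬝ᵥ star x.ofLp = star (x.ofLp ⬝ᵥ star w) := by
      simp [dotProduct, mul_comm]
    rw [this, Complex.star_def, Complex.mul_conj']
    norm_cast
  have h2 : ∀ w : Fin d → ℂ, ∑ k, reForm (vecMulVec w (star w)) (C (e k)).ofLp ≤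
      (vecMulVec w (star w)).trace.re := fun w => by
    have h3 := trace_rankOneMat_self (WithLp.toLp 2 w)
    rw [mat_rankOneMat] at h3
    simp only [h1, ← LinearMap.adjoint_inner_left]
    rw [h3, e.sum_sq_norm_inner_left, Complex.ofReal_re]
    have := norm_adjoint_apply_le hC (WithLp.toLp 2 w)
    gcongr
  have h4 : ∀ x : Fin d → ℂ, reForm (∑ i, vecMulVec (v i) (star (v i))) x =
      ∑ i, reForm (vecMulVec (v i) (star (v i))) x := fun x => by
    simp [reForm, sum_mulVec, dotProduct_sum]
  simp only [h4, trace_sum, Complex.re_sum]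
  rw [Finset.sum_comm]
  exact Finset.sum_le_sum fun i _ => h2 (v i)

theorem reForm_blockMat_two (B : Matrix (Fin 2) (Fin 2) (TraceMat d)) (x : Fin 2 → Fin d → ℂ) :
    reForm (blockMat B) (fun p => x p.1 p.2) = reForm (TraceMat.mat (B 0 0)) (x 0) +
      (star (x 0) ⬝ᵥ (TraceMat.mat (B 0 1) *ᵥ x 1)).re +
      (star (x 1) ⬝ᵥ (TraceMat.mat (B 1 0) *ᵥ x 0)).re + reForm (TraceMat.mat (B 1 1)) (x 1) := by
  simp only [reForm, ← Complex.add_re]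
  congr 1
  simp only [dotProduct, mulVec, Fintype.sum_prod_type, Fin.sum_univ_two, blockMat, of_apply,
    Pi.star_apply, mul_add, Finset.sum_add_distrib]
  ring

/-- Let `C` be a contraction for which `Tr C* B₀₁` attains the trace norm in its real part. Testing
the block form on the vectors `(C e_k, -e_k)` bounds twice the real part of each pairing by diagonal
terms; summing over `k` gives the two traces. -/
theorem traceNorm_offDiag_le {B : Matrix (Fin 2) (Fin 2) (TraceMat d)}
    (hB : (blockMat B).PosSemidef) :
    2 * ‖B 0 1‖ ≤ (TraceMat.mat (B 0 0)).trace.re + (TraceMat.mat (B 1 1)).trace.re := by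
  obtain ⟨C, hC, h⟩ := traceNorm.exists_contraction (TraceMat.mat (B 0 1))
  let e := EuclideanSpace.basisFun (Fin d) ℂ
  have hdiag : ∀ i, (TraceMat.mat (B i i)).PosSemidef := fun i =>
    hB.submatrix fun a => (i, a)
  have h10 : TraceMat.mat (B 1 0) = (TraceMat.mat (B 0 1))ᴴ :=
    (blockMat_isHermitian_iff.1 hB.isHermitian 0 1).symm
  have hk : ∀ k, 2 * (⟪C (e k), toEuclideanLin (TraceMat.mat (B 0 1)) (e k)⟫_ℂ).re ≤
      reForm (TraceMat.mat (B 0 0)) (C (e k)).ofLp +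
        reForm (TraceMat.mat (B 1 1)) (LinearMap.id (R := ℂ) (e k)).ofLp := fun k => by
    have h1 := (posSemidef_iff_reForm_nonneg hB.isHermitian).1 hB
      (fun p => (![(C (e k)).ofLp, -(e k).ofLp] : Fin 2 → Fin d → ℂ) p.1 p.2)
    rw [reForm_blockMat_two] at h1
    have h2 : star (C (e k)).ofLp ⬝ᵥ (TraceMat.mat (B 0 1) *ᵥ (e k).ofLp) =
        ⟪C (e k), toEuclideanLin (TraceMat.mat (B 0 1)) (e k)⟫_ℂ := by
      rw [EuclideanSpace.inner_eq_star_dotProduct, dotProduct_comm]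
      rfl
    have h3 : star (e k).ofLp ⬝ᵥ (TraceMat.mat (B 1 0) *ᵥ (C (e k)).ofLp) =
        star (star (C (e k)).ofLp ⬝ᵥ (TraceMat.mat (B 0 1) *ᵥ (e k).ofLp)) := by
      rw [h10, star_dotProduct, star_mulVec, conjTranspose_conjTranspose, ← dotProduct_mulVec]
    have h4 : reForm (TraceMat.mat (B 1 1)) (-(e k).ofLp) =
        reForm (TraceMat.mat (B 1 1)) (e k).ofLp := by simp [reForm, mulVec_neg]
    simp only [cons_val_zero, cons_val_one, mulVec_neg, dotProduct_neg, star_neg, neg_dotProduct,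
      h3, h2, h4, Complex.neg_re, Complex.star_def, Complex.conj_re] at h1
    rw [LinearMap.id_apply]
    linarith
  have h5 := sum_reForm_le_trace (hdiag 0) hC e
  have h6 := sum_reForm_le_trace (hdiag 1) (C := LinearMap.id) (fun x => le_rfl) e
  rw [TraceMat.norm_def, ← h e, Complex.re_sum, Finset.mul_sum]
  refine (Finset.sum_le_sum fun k _ => hk k).trans ?_
  rw [Finset.sum_add_distrib]
  exact add_le_add h5 h6

variable {A : TraceMat d →L[ℂ] TraceMat d}

/-- The block matrix with entries `xx*`, `xy*`, `yx*`, `yy*` is a rank one positive matrix. Its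
image under the second amplification is positive with unchanged diagonal traces, so the off-diagonal
estimate applies. -/
theorem norm_apply_rankOneMat_le (hCP : IsCP A) (hTP : IsTP A)
    (x y : EuclideanSpace ℂ (Fin d)) :
    2 * ‖A (rankOneMat x y)‖ ≤ ‖x‖ ^ 2 + ‖y‖ ^ 2 := by
  let w : Fin 2 → EuclideanSpace ℂ (Fin d) := ![x, y]
  let B : Matrix (Fin 2) (Fin 2) (TraceMat d) := Matrix.of fun i j => rankOneMat (w i) (w j)
  have hB : blockMat B = vecMulVec (fun p => (w p.1).ofLp p.2)
      (star fun p => (w p.1).ofLp p.2) := by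
    ext p q
    rfl
  have h := traceNorm_offDiag_le (hCP 2 B (hB ▸ posSemidef_vecMulVec_self_star _))
  simp only [map_apply, hTP _] at h
  simp only [B, of_apply, trace_rankOneMat_self, Complex.ofReal_re] at h
  exact h

theorem norm_le_one_of_isCP_of_isTP (hCP : IsCP A) (hTP : IsTP A) : ‖A‖ ≤ 1 := by
  have h1 : ∀ x y : EuclideanSpace ℂ (Fin d), ‖y‖ = 1 → ‖A (rankOneMat x y)‖ ≤ ‖x‖ := by
    intro x y hy
    by_cases hx : x = 0
    · subst hx
      have := rankOneMat_smul_left 0 0 y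
      rw [zero_smul, zero_smul] at this
      simp [this]
    · have hx' : 0 < ‖x‖ := norm_pos_iff.2 hx
      have h2 := norm_apply_rankOneMat_le hCP hTP ((‖x‖⁻¹ : ℂ) • x) y
      rw [rankOneMat_smul_left, map_smul, norm_smul, norm_smul, norm_inv, Complex.norm_real,
        norm_norm, hy, inv_mul_cancel₀ hx'.ne'] at h2
      have h3 : ‖x‖⁻¹ * ‖A (rankOneMat x y)‖ ≤ 1 := by linarith
      rwa [inv_mul_le_iff₀ hx', mul_one] at h3
  refine ContinuousLinearMap.opNorm_le_bound _ zero_le_one fun a => ?_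
  -- In this eigenbasis of `a* a` the sum of the norms `‖a e_i‖` equals the trace norm exactly, so
  -- the bound on rank one pieces loses nothing.
  let e := traceNorm.rightBasis (TraceMat.mat a)
  rw [one_mul, TraceMat.norm_def a, traceNorm.eq_sum_norm]
  conv_lhs => rw [eq_sum_rankOneMat a e, map_sum]
  refine (norm_sum_le _ _).trans (Finset.sum_le_sum fun i _ => ?_)
  exact h1 _ _ (e.norm_eq_one i)

end TraceNormContraction

end Howland

namespace Howland

/-! ### Translations of the Bochner space -/

section Translation

variable {d : ℕ} {T : ℝ} [Fact (0 < T)]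

theorem measurePreserving_circle_sub (τ : ℝ) :
    MeasurePreserving (fun t : AddCircle T => t - (τ : AddCircle T)) AddCircle.haarAddCircle
      AddCircle.haarAddCircle :=
  measurePreserving_sub_right _ _

variable (d T) in
/-- The translation `f ↦ f(· - τ)` of the Bochner space. -/
noncomputable def translation (τ : ℝ) : FloquetSpace d T →L[ℂ] FloquetSpace d T :=
  (Lp.compMeasurePreservingₗᵢ ℂ _ (measurePreserving_circle_sub (T := T) τ)).toContinuousLinearMap

theorem norm_translation (τ : ℝ) (f : FloquetSpace d T) : ‖translation d T τ f‖ = ‖f‖ :=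
  LinearIsometry.norm_map _ f

theorem translation_coeFn (τ : ℝ) (f : FloquetSpace d T) :
    translation d T τ f =ᵐ[AddCircle.haarAddCircle] fun t => f (t - (τ : AddCircle T)) :=
  Lp.coeFn_compMeasurePreserving f (measurePreserving_circle_sub (T := T) τ)

theorem continuous_translation (f : FloquetSpace d T) :
    Continuous fun τ : ℝ => translation d T τ f := by
  refine Continuous.compMeasurePreservingLp (p := 2) (f := fun _ : ℝ => f)
    (g := fun τ : ℝ => (⟨fun t : AddCircle T => t - (τ : AddCircle T), by fun_prop⟩ :
      C(AddCircle T, AddCircle T))) continuous_const ?_ measurePreserving_circle_sub (by simp)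
  refine ContinuousMap.continuous_of_continuous_uncurry _ ?_
  exact continuous_snd.sub ((AddCircle.continuous_mk' T).comp continuous_fst)

theorem translation_contToFloquet (τ : ℝ) (f : C(AddCircle T, TraceMat d)) :
    translation d T τ (contToFloquet f) = contToFloquet
      (f.comp ⟨fun t : AddCircle T => t - (τ : AddCircle T), by fun_prop⟩) := by
  refine Lp.ext ?_
  have h := (measurePreserving_circle_sub (T := T) τ).quasiMeasurePreserving.ae
    (ContinuousMap.coeFn_toLp (p := 2) (𝕜 := ℂ) AddCircle.haarAddCircle f)
  filter_upwards [h, translation_coeFn τ (contToFloquet f),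
    ContinuousMap.coeFn_toLp (p := 2) (𝕜 := ℂ) AddCircle.haarAddCircle
      (f.comp ⟨fun t : AddCircle T => t - (τ : AddCircle T), by fun_prop⟩)] with t h1 h2 h3
  rw [h2]
  exact h1.trans h3.symm

/-- The line is a countable union of period intervals, on each of which the quotient map preserves
measure; normalized Haar measure and length on the circle differ by a constant factor. -/
theorem ae_real_of_ae_circle {p : AddCircle T → Prop}
    (h : ∀ᵐ u ∂(@AddCircle.haarAddCircle T _), p u) : ∀ᵐ t : ℝ, p (t : AddCircle T) := by
  have hv : ∀ᵐ u : AddCircle T, p u := by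
    rw [AddCircle.volume_eq_smul_haarAddCircle]
    exact Measure.ae_smul_measure h _
  have hT : 0 < T := Fact.out
  rw [← Measure.restrict_univ (μ := (volume : Measure ℝ)), ← iUnion_Ioc_zsmul hT,
    ae_restrict_iUnion_eq, eventually_iSup]
  intro n
  have := (AddCircle.measurePreserving_mk T (n • T)).quasiMeasurePreserving.ae hv
  rwa [← add_one_zsmul] at this

end Translation

/-! ### Multiplication by operator-valued functions -/

section PointwiseOp

variable {d : ℕ} {T : ℝ} [Fact (0 < T)]

/-- `pointwiseOp` as a continuous linear map of the family. -/
noncomputable def pointwiseOpL : C(AddCircle T, TraceMat d →L[ℂ] TraceMat d) →L[ℂ]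
    FloquetSpace d T →L[ℂ] FloquetSpace d T :=
  ((ContinuousLinearMap.id ℂ (TraceMat d →L[ℂ] TraceMat d)).holderL
    AddCircle.haarAddCircle ∞ 2 2) ∘L (ContinuousMap.toLp ∞ AddCircle.haarAddCircle ℂ)

theorem pointwiseOpL_apply (A : C(AddCircle T, TraceMat d →L[ℂ] TraceMat d)) :
    pointwiseOpL A = pointwiseOp A := rfl

theorem pointwiseOp_const_one :
    pointwiseOp (ContinuousMap.const (AddCircle T) (1 : TraceMat d →L[ℂ] TraceMat d)) = 1 := by
  refine ContinuousLinearMap.ext fun f => Lp.ext ?_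
  filter_upwards [pointwiseOp_coeFn (ContinuousMap.const (AddCircle T)
    (1 : TraceMat d →L[ℂ] TraceMat d)) f] with t h
  rw [h]; rfl

theorem norm_pointwiseOp_apply_le {A : C(AddCircle T, TraceMat d →L[ℂ] TraceMat d)}
    (hA : ∀ t, ‖A t‖ ≤ 1) (f : FloquetSpace d T) : ‖pointwiseOp A f‖ ≤ ‖f‖ := by
  refine Lp.norm_le_norm_of_ae_le ?_
  filter_upwards [pointwiseOp_coeFn A f] with t h
  rw [h]
  exact ((A t).le_opNorm _).trans (mul_le_of_le_one_left (norm_nonneg _) (hA t))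

end PointwiseOp

/-! ### The Howland semigroup -/

section Evolution

variable {d : ℕ} {T : ℝ} [Fact (0 < T)] {L : C(AddCircle T, TraceMat d →L[ℂ] TraceMat d)}
  {Lam : ℝ → TraceMat d →L[ℂ] TraceMat d}
  (hLam : ∀ t : ℝ, HasDerivAt Lam (L (t : AddCircle T) * Lam t) t) (hLam0 : Lam 0 = 1)

theorem periodic_stepPropagator (hLam : ∀ t : ℝ, HasDerivAt Lam (L (t : AddCircle T) * Lam t) t)
    (hLam0 : Lam 0 = 1) (τ : ℝ) :
    Function.Periodic (fun t => propagator Lam t (t - τ)) T := fun t => by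
  simp only
  rw [← propagator_add_period hLam hLam0 t (t - τ)]
  congr 1
  ring

/-- The continuous periodic family `t ↦ V_{t,t-τ}`. -/
noncomputable def stepFamily (hLam : ∀ t : ℝ, HasDerivAt Lam (L (t : AddCircle T) * Lam t) t)
    (hLam0 : Lam 0 = 1) (τ : ℝ) : C(AddCircle T, TraceMat d →L[ℂ] TraceMat d) :=
  ⟨(periodic_stepPropagator hLam hLam0 τ).lift, Continuous.quotient_lift
    ((continuous_propagator hLam hLam0).comp
      (continuous_id.prodMk (continuous_id.sub continuous_const))) _⟩

theorem stepFamily_coe (τ t : ℝ) :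
    stepFamily hLam hLam0 τ (t : AddCircle T) = propagator Lam t (t - τ) := rfl

theorem stepFamily_zero :
    stepFamily hLam hLam0 0 = ContinuousMap.const (AddCircle T) 1 := by
  ext1 u
  induction u using QuotientAddGroup.induction_on with | _ t
  rw [stepFamily_coe, sub_zero, propagator_self hLam hLam0]
  rfl

/-- The cocycle law `V_{t,t-σ-τ} = V_{t,t-σ} V_{t-σ,t-σ-τ}`, from which the semigroup law follows.
-/
theorem stepFamily_add (σ τ : ℝ) (u : AddCircle T) :
    stepFamily hLam hLam0 (σ + τ) u =
      stepFamily hLam hLam0 σ u * stepFamily hLam hLam0 τ (u - (σ : AddCircle T)) := by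
  induction u using QuotientAddGroup.induction_on with | _ t
  rw [← AddCircle.coe_sub, stepFamily_coe, stepFamily_coe, stepFamily_coe,
    propagator_mul hLam hLam0, sub_sub]

theorem continuous_stepFamily : Continuous (stepFamily hLam hLam0) := by
  refine ContinuousMap.continuous_of_continuous_uncurry _ ?_
  -- The covering is an open map, so its product with the identity is still a quotient map and joint
  -- continuity can be tested on `ℝ × ℝ`.
  have hq : IsOpenQuotientMap (Prod.map id ((↑) : ℝ → AddCircle T) : ℝ × ℝ → ℝ × AddCircle T) :=
    IsOpenQuotientMap.id.prodMap QuotientAddGroup.isOpenQuotientMap_mk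
  rw [← hq.continuous_comp_iff]
  exact (continuous_propagator hLam hLam0).comp
    (continuous_snd.prodMk (continuous_snd.sub continuous_fst))

theorem norm_stepFamily_le (hL : ∀ t, IsStandardForm (L t)) {τ : ℝ} (hτ : 0 ≤ τ)
    (u : AddCircle T) : ‖stepFamily hLam hLam0 τ u‖ ≤ 1 := by
  induction u using QuotientAddGroup.induction_on with | _ t
  rw [stepFamily_coe]
  exact norm_le_one_of_isCP_of_isTP (isCP_propagator hL hLam hLam0 (by linarith))
    (isTP_propagator hL hLam hLam0 _ _)

/-- The operator `W_τ(f)(t) = V_{t,t-τ}(f(t-τ))`. -/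
noncomputable def evolution (hLam : ∀ t : ℝ, HasDerivAt Lam (L (t : AddCircle T) * Lam t) t)
    (hLam0 : Lam 0 = 1) (τ : ℝ≥0) : FloquetSpace d T →L[ℂ] FloquetSpace d T :=
  pointwiseOp (stepFamily hLam hLam0 τ) ∘L translation d T τ

theorem evolution_coeFn (τ : ℝ≥0) (f : FloquetSpace d T) :
    evolution hLam hLam0 τ f =ᵐ[AddCircle.haarAddCircle] fun t =>
      stepFamily hLam hLam0 τ t (f (t - ((τ : ℝ) : AddCircle T))) := by
  filter_upwards [pointwiseOp_coeFn (stepFamily hLam hLam0 τ) (translation d T τ f),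
    translation_coeFn (τ : ℝ) f] with t h1 h2
  rw [← h2, ← h1]
  rfl

theorem isHowlandFamily_evolution : IsHowlandFamily Lam (evolution hLam hLam0) := by
  intro τ f
  filter_upwards [ae_real_of_ae_circle (evolution_coeFn hLam hLam0 τ f)] with t h
  rw [h, stepFamily_coe, AddCircle.coe_sub]

theorem translation_zero : translation d T 0 = 1 := by
  refine ContinuousLinearMap.ext fun f => Lp.ext ?_
  filter_upwards [translation_coeFn 0 f] with t h
  rw [h]
  simp

theorem isContractionSemigroup_evolution (hL : ∀ t, IsStandardForm (L t)) :
    IsContractionSemigroup (evolution hLam hLam0) where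
  zero := by
    rw [evolution, NNReal.coe_zero, stepFamily_zero, pointwiseOp_const_one, translation_zero]
    rfl
  add σ τ := by
    refine ContinuousLinearMap.ext fun f => Lp.ext ?_
    have h := (measurePreserving_circle_sub (T := T) σ).quasiMeasurePreserving.ae
      (evolution_coeFn hLam hLam0 τ f)
    filter_upwards [evolution_coeFn hLam hLam0 (σ + τ) f,
      evolution_coeFn hLam hLam0 σ (evolution hLam hLam0 τ f), h] with t h1 h2 h3
    rw [ContinuousLinearMap.mul_def, ContinuousLinearMap.comp_apply, h1, h2, h3, NNReal.coe_add, stepFamily_add,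
      AddCircle.coe_add, sub_sub]
    rfl
  continuous f := by
    -- The multiplication factor is continuous in operator norm; paired with strong continuity of
    -- translations this gives strong continuity of the product.
    have h1 : Continuous fun τ : ℝ≥0 => pointwiseOpL (stepFamily hLam hLam0 τ) :=
      pointwiseOpL.continuous.comp ((continuous_stepFamily hLam hLam0).comp NNReal.continuous_coe)
    exact h1.clm_apply ((continuous_translation f).comp NNReal.continuous_coe)
  contraction τ := by
    refine ContinuousLinearMap.opNorm_le_bound _ zero_le_one fun f => ?_
    rw [one_mul]
    exact (norm_pointwiseOp_apply_le (norm_stepFamily_le hLam hLam0 hL τ.2) _).trans_eq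
      (norm_translation _ f)

variable (d T) in
theorem isContractionSemigroup_translation :
    IsContractionSemigroup fun τ : ℝ≥0 => translation d T (τ : ℝ) where
  zero := translation_zero
  add σ τ := by
    refine ContinuousLinearMap.ext fun f => Lp.ext ?_
    have h := (measurePreserving_circle_sub (T := T) σ).quasiMeasurePreserving.ae
      (translation_coeFn τ f)
    filter_upwards [translation_coeFn ((σ + τ : ℝ≥0) : ℝ) f,
      translation_coeFn σ (translation d T τ f), h] with t h1 h2 h3
    rw [ContinuousLinearMap.mul_def, ContinuousLinearMap.comp_apply, h1, h2, h3, NNReal.coe_add, AddCircle.coe_add, sub_sub]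
  continuous f := (continuous_translation f).comp NNReal.continuous_coe
  contraction τ := ContinuousLinearMap.opNorm_le_bound _ zero_le_one fun f => by
    rw [one_mul, norm_translation]

end Evolution

end Howland

namespace Howland

/-! ### Positivity and trace on the Bochner space and the tensor product -/

section BochnerPositivity

/-- The witness is `√|M|`: the modulus is continuous, takes values in the positive cone, where the
square root is continuous, and fixes positive matrices. Global continuity makes square roots of
measurable families measurable. -/
theorem exists_continuous_matrix_sqrt (N : Type*) [Fintype N] [DecidableEq N] :
    ∃ s : Matrix N N ℂ → Matrix N N ℂ, Continuous s ∧
      ∀ P : Matrix N N ℂ, P.PosSemidef → (s P).conjTranspose * s P = P := by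
  open scoped Matrix.Norms.L2Operator MatrixOrder in
  refine ⟨fun M => CFC.sqrt (CFC.abs M), ?_, fun P hP => ?_⟩
  · open scoped Matrix.Norms.L2Operator MatrixOrder in
    exact CFC.continuousOn_sqrt.comp_continuous CFC.continuous_abs fun M => CFC.abs_nonneg M
  · open scoped Matrix.Norms.L2Operator MatrixOrder in
    have h : (0 : Matrix N N ℂ) ≤ P := hP.nonneg
    simp only
    rw [CFC.abs_of_nonneg P h,
      (Matrix.nonneg_iff_posSemidef.1 (CFC.sqrt_nonneg P)).isHermitian.eq,
      CFC.sqrt_mul_sqrt_self P h]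

variable {d : ℕ} {T : ℝ} [Fact (0 < T)] {n : ℕ}

theorem aestronglyMeasurable_blockMat (f : Matrix (Fin n) (Fin n) (FloquetSpace d T)) :
    AEStronglyMeasurable (fun t => blockMat (f.map fun h => h t))
      (@AddCircle.haarAddCircle T _) := by
  let φ : Matrix (Fin n) (Fin n) (TraceMat d) →+ Matrix (Fin n × Fin d) (Fin n × Fin d) ℂ :=
    AddMonoidHom.mk' blockMat blockMat_add
  have h : (fun t => blockMat (f.map fun h => h t)) =
      fun t => ∑ i, ∑ j, φ (Matrix.single i j (f i j t)) := by
    funext t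
    simp only [← map_sum]
    conv_lhs => rw [Matrix.matrix_eq_sum_single (f.map fun h => h t)]
    rfl
  rw [h]
  refine Finset.aestronglyMeasurable_fun_sum _ fun i _ =>
    Finset.aestronglyMeasurable_fun_sum _ fun j _ => ?_
  have hc : Continuous fun x : TraceMat d => φ (Matrix.single i j x) :=
    continuous_blockMat.comp (continuous_matrix fun i' j' => by
      by_cases h : i = i' ∧ j = j'
      · simpa [Matrix.single_apply, h] using continuous_id'
      · simpa [Matrix.single_apply, h] using continuous_const)
  exact hc.comp_aestronglyMeasurable (Lp.aestronglyMeasurable (f i j))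

theorem memLp_of_entries {M : AddCircle T → Matrix (Fin d) (Fin d) ℂ}
    (h : ∀ a b, MemLp (fun t => M t a b) 2 (@AddCircle.haarAddCircle T _)) :
    MemLp (fun t => TraceMat.mat.symm (M t)) 2 (@AddCircle.haarAddCircle T _) := by
  have h1 : (fun t => TraceMat.mat.symm (M t)) = fun t => ∑ a, ∑ b,
      (ContinuousLinearMap.id ℂ ℂ).smulRight
        (TraceMat.mat.symm (Matrix.single a b (1 : ℂ))) (M t a b) := by
    funext t
    conv_lhs => rw [Matrix.matrix_eq_sum_single (M t)]
    simp only [map_sum]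
    refine Finset.sum_congr rfl fun a _ => Finset.sum_congr rfl fun b _ => ?_
    rw [ContinuousLinearMap.smulRight_apply, ContinuousLinearMap.id_apply, ← map_smul,
      Matrix.smul_single, smul_eq_mul, mul_one]
  rw [h1]
  exact memLp_finsetSum _ fun a _ => memLp_finsetSum _ fun b _ =>
    ContinuousLinearMap.comp_memLp' _ (h a b)

/-- The entry `(a, b)` of a matrix, as a continuous linear functional. -/
noncomputable def entryL (a b : Fin d) : TraceMat d →L[ℂ] ℂ :=
  LinearMap.toContinuousLinearMap (Matrix.entryLinearMap ℂ ℂ a b ∘ₗ TraceMat.mat.toLinearMap)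


/-- A single square suffices for the converse: take `g` to be the pointwise square root. Along
column `q`, the squared moduli of its entries sum to the diagonal entry `P q q`, which is integrable
because the measure is finite, so `g` has square integrable entries. -/
theorem mem_posCone_iff (f : Matrix (Fin n) (Fin n) (FloquetSpace d T)) :
    f ∈ posCone n ↔ ∀ᵐ t ∂(@AddCircle.haarAddCircle T _),
      (blockMat (f.map fun h => h t)).PosSemidef := by
  constructor
  · rintro ⟨m, g, hg⟩
    filter_upwards [hg] with t ht
    rw [ht]
    exact Matrix.posSemidef_sum _ fun j _ => Matrix.posSemidef_conjTranspose_mul_self _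
  · intro h
    obtain ⟨s, hs, hs'⟩ := exists_continuous_matrix_sqrt (Fin n × Fin d)
    let P : AddCircle T → Matrix (Fin n × Fin d) (Fin n × Fin d) ℂ := fun t =>
      blockMat (f.map fun h => h t)
    have hsP : AEStronglyMeasurable (fun t => s (P t)) (@AddCircle.haarAddCircle T _) :=
      hs.comp_aestronglyMeasurable (aestronglyMeasurable_blockMat f)
    have hentry : ∀ p q, MemLp (fun t => s (P t) p q) 2 (@AddCircle.haarAddCircle T _) := by
      intro p q
      have hm : AEStronglyMeasurable (fun t => s (P t) p q) (@AddCircle.haarAddCircle T _) :=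
        (continuous_id.matrix_elem p q).comp_aestronglyMeasurable hsP
      rw [memLp_two_iff_integrable_sq_norm hm]
      have hi : Integrable (fun t => entryL q.2 q.2 (f q.1 q.1 t))
          (@AddCircle.haarAddCircle T _) :=
        (entryL q.2 q.2).integrable_comp ((Lp.memLp (f q.1 q.1)).integrable (by norm_num))
      refine hi.mono (hm.norm.pow 2) ?_
      filter_upwards [h] with t ht
      have h1 : (P t) q q = ((∑ r, ‖s (P t) r q‖ ^ 2 : ℝ) : ℂ) := by
        have h3 : (s (P t)).conjTranspose * s (P t) = P t := hs' _ ht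
        conv_lhs => rw [← h3]
        rw [Matrix.mul_apply, Complex.ofReal_sum]
        refine Finset.sum_congr rfl fun r _ => ?_
        rw [Matrix.conjTranspose_apply, Complex.star_def, Complex.conj_mul', Complex.ofReal_pow]
      have h2 : entryL q.2 q.2 (f q.1 q.1 t) = (P t) q q := rfl
      rw [h2, h1, Complex.norm_real, norm_pow, norm_norm, Real.norm_of_nonneg
        (Finset.sum_nonneg fun _ _ => sq_nonneg _)]
      exact Finset.single_le_sum (f := fun r => ‖s (P t) r q‖ ^ 2) (fun _ _ => sq_nonneg _)
        (Finset.mem_univ p)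
    have hblock : ∀ i j, MemLp (fun t => TraceMat.mat.symm
        (Matrix.of fun a b => s (P t) (i, a) (j, b))) 2 (@AddCircle.haarAddCircle T _) :=
      fun i j => memLp_of_entries fun a b => hentry (i, a) (j, b)
    refine ⟨1, fun _ => Matrix.of fun i j => (hblock i j).toLp _, ?_⟩
    have hae : ∀ᵐ t ∂(@AddCircle.haarAddCircle T _), ∀ i j, (hblock i j).toLp _ t =
        TraceMat.mat.symm (Matrix.of fun a b => s (P t) (i, a) (j, b)) :=
      ae_all_iff.2 fun i => ae_all_iff.2 fun j => (hblock i j).coeFn_toLp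
    filter_upwards [h, hae] with t ht ht'
    have hg : blockMat ((Matrix.of fun i j => (hblock i j).toLp _).map fun h => h t) = s (P t) := by
      ext p q
      rw [blockMat, Matrix.of_apply, Matrix.map_apply, Matrix.of_apply, ht']
      rfl
    rw [Fin.sum_univ_one, hg]
    exact (hs' _ ht).symm

variable {L : C(AddCircle T, TraceMat d →L[ℂ] TraceMat d)}
  {Lam : ℝ → TraceMat d →L[ℂ] TraceMat d}
  (hL : ∀ t, IsStandardForm (L t))
  (hLam : ∀ t : ℝ, HasDerivAt Lam (L (t : AddCircle T) * Lam t) t) (hLam0 : Lam 0 = 1)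

include hL in
theorem isCPBochner_evolution (τ : ℝ≥0) : IsCPBochner (evolution hLam hLam0 τ) := by
  intro n f hf
  rw [mem_posCone_iff] at hf ⊢
  have h1 := (measurePreserving_circle_sub (T := T) τ).quasiMeasurePreserving.ae hf
  have h2 : ∀ᵐ t ∂(@AddCircle.haarAddCircle T _), ∀ i j, evolution hLam hLam0 τ (f i j) t =
      stepFamily hLam hLam0 τ t (f i j (t - ((τ : ℝ) : AddCircle T))) :=
    ae_all_iff.2 fun i => ae_all_iff.2 fun j => evolution_coeFn hLam hLam0 τ (f i j)
  filter_upwards [h1, h2] with t h1 h2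
  have h3 : (f.map (evolution hLam hLam0 τ)).map (fun h => h t) =
      (f.map fun h => h (t - ((τ : ℝ) : AddCircle T))).map (stepFamily hLam hLam0 τ t) := by
    ext1 i j
    exact h2 i j
  rw [h3]
  have h4 : IsCP (stepFamily hLam hLam0 τ t) := by
    induction t using QuotientAddGroup.induction_on with | _ t
    rw [stepFamily_coe]
    exact isCP_propagator hL hLam hLam0 (sub_le_self t τ.2)
  exact h4 n _ h1

include hL in
theorem isTPBochner_evolution (τ : ℝ≥0) : IsTPBochner (evolution hLam hLam0 τ) := by
  intro f
  have h : ∀ᵐ t ∂(@AddCircle.haarAddCircle T _),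
      (TraceMat.mat (evolution hLam hLam0 τ f t)).trace =
        (TraceMat.mat (f (t - ((τ : ℝ) : AddCircle T)))).trace := by
    filter_upwards [evolution_coeFn hLam hLam0 τ f] with t ht
    rw [ht]
    induction t using QuotientAddGroup.induction_on with | _ t
    rw [stepFamily_coe]
    exact isTP_propagator hL hLam hLam0 _ _ _
  rw [bochnerTrace, integral_congr_ae h,
    integral_sub_right_eq_self (fun t => (TraceMat.mat (f t)).trace)]
  rfl

theorem isCPTensor_fourierLift {A : FloquetSpace d T →L[ℂ] FloquetSpace d T}
    (hA : IsCPBochner A) : IsCPTensor (fourierLift A) := by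
  intro n f hf
  have h : (f.map (fourierLift A)).map iota = (f.map iota).map A := by
    ext1 i j
    simp [fourierLift_apply]
  rw [tensorPosCone, Set.mem_ofPred_eq, h]
  exact hA n _ hf

theorem isTPTensor_fourierLift {A : FloquetSpace d T →L[ℂ] FloquetSpace d T}
    (hA : IsTPBochner A) : IsTPTensor (fourierLift A) := by
  intro f
  rw [tensorTrace, fourierLift_apply, LinearIsometryEquiv.apply_symm_apply]
  exact hA _

end BochnerPositivity

end Howland

namespace Howland

/-! ### Uniform difference quotients on the circle -/

section UniformDerivative

theorem norm_sub_sub_smul_le {E : Type*} [NormedAddCommGroup E] [NormedSpace ℝ E] {h h' : ℝ → E}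
    {a b ε : ℝ} {y : E} (hab : a ≤ b) (hd : ∀ r, HasDerivAt h (h' r) r)
    (hb : ∀ r ∈ Set.Icc a b, ‖h' r - y‖ ≤ ε) : ‖h b - h a - (b - a) • y‖ ≤ ε * (b - a) := by
  have h1 : ∀ r ∈ Set.Icc a b, HasDerivWithinAt (fun r => h r - r • y) (h' r - y)
      (Set.Icc a b) r := fun r _ => by
    have := ((hd r).sub ((hasDerivAt_id r).smul_const y)).hasDerivWithinAt (s := Set.Icc a b)
    exact this.congr_deriv (by simp)
  have h2 := norm_image_sub_le_of_norm_deriv_le_segment' h1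
    (fun r hr => hb r (Set.Ico_subset_Icc_self hr)) b (Set.right_mem_Icc.2 hab)
  refine le_of_eq_of_le ?_ h2
  congr 1
  rw [sub_smul]
  abel

variable {T : ℝ} [Fact (0 < T)]

theorem exists_dist_circle_lt {E : Type*} [NormedAddCommGroup E] (f : C(AddCircle T, E)) {ε : ℝ}
    (hε : 0 < ε) : ∃ δ > 0, ∀ r t : ℝ, |r - t| < δ →
      ‖f (r : AddCircle T) - f (t : AddCircle T)‖ < ε := by
  obtain ⟨δ, hδ, h⟩ := Metric.uniformContinuous_iff.1
    (CompactSpace.uniformContinuous_of_continuous f.continuous) ε hε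
  refine ⟨δ, hδ, fun r t hrt => ?_⟩
  rw [← dist_eq_norm]
  refine h (lt_of_le_of_lt ?_ hrt)
  rw [dist_eq_norm, ← AddCircle.coe_sub, ← Real.norm_eq_abs]
  exact QuotientAddGroup.norm_mk_le_norm

theorem tendsto_continuousMap_of_forall_coe {E : Type*} [NormedAddCommGroup E]
    {F : ℝ≥0 → C(AddCircle T, E)} {G : C(AddCircle T, E)}
    (h : ∀ ε > 0, ∃ δ > 0, ∀ τ : ℝ≥0, 0 < τ → (τ : ℝ) < δ → ∀ t : ℝ,
      ‖F τ (t : AddCircle T) - G (t : AddCircle T)‖ ≤ ε) :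
    Tendsto F (𝓝[>] 0) (𝓝 G) := by
  rw [Metric.tendsto_nhds]
  intro ε hε
  -- Halving turns the non-strict pointwise bounds into a strict bound on the supremum norm.
  obtain ⟨δ, hδ, hF⟩ := h (ε / 2) (half_pos hε)
  have h1 : ∀ᶠ τ : ℝ≥0 in 𝓝[>] 0, (τ : ℝ) < δ :=
    (NNReal.continuous_coe.tendsto' 0 0 rfl).mono_left nhdsWithin_le_nhds |>.eventually
      (gt_mem_nhds hδ)
  filter_upwards [h1, self_mem_nhdsWithin] with τ h1 h2
  rw [dist_eq_norm]
  refine lt_of_le_of_lt ((ContinuousMap.norm_le _ (half_pos hε).le).2 fun u => ?_)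
    (half_lt_self hε)
  induction u using QuotientAddGroup.induction_on with | _ t
  exact hF τ h2 h1 t

end UniformDerivative

/-! ### The generator as a bounded perturbation of the translation generator -/

section Generator

variable {d : ℕ} {T : ℝ} [Fact (0 < T)] {L : C(AddCircle T, TraceMat d →L[ℂ] TraceMat d)}
  {Lam : ℝ → TraceMat d →L[ℂ] TraceMat d}
  (hL : ∀ t, IsStandardForm (L t))
  (hLam : ∀ t : ℝ, HasDerivAt Lam (L (t : AddCircle T) * Lam t) t) (hLam0 : Lam 0 = 1)

include hL hLam hLam0 in
theorem norm_propagator_sub_one_le {s r : ℝ} (h : s ≤ r) :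
    ‖propagator Lam r s - 1‖ ≤ ‖L‖ * (r - s) := by
  have h1 := norm_image_sub_le_of_norm_deriv_le_segment' (a := s) (b := r) (C := ‖L‖)
    (fun x _ => (hasDerivAt_propagator hLam hLam0 x s).hasDerivWithinAt)
    (fun x hx => ?_) r (Set.right_mem_Icc.2 h)
  · rwa [propagator_self hLam hLam0] at h1
  · refine (norm_mul_le _ _).trans ?_
    have h2 := norm_le_one_of_isCP_of_isTP (isCP_propagator hL hLam hLam0 hx.1)
      (isTP_propagator hL hLam hLam0 x s)
    exact (mul_le_of_le_one_right (norm_nonneg _) h2).trans (norm_coeff_le L _)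

include hL in
-- By the mean value inequality on `[t-τ, t]` it suffices that the derivative `L_r V_{r,t-τ}` be
-- close to `L_t`. The error splits into the oscillation of `L`, controlled by uniform continuity,
-- and `L_r (V_{r,t-τ} - 1)`, of size at most `‖L‖² τ`.
theorem tendsto_stepFamily_sub_one :
    Tendsto (fun τ : ℝ≥0 => ((τ : ℝ) : ℂ)⁻¹ • (stepFamily hLam hLam0 τ -
      ContinuousMap.const (AddCircle T) 1)) (𝓝[>] 0) (𝓝 L) := by
  refine tendsto_continuousMap_of_forall_coe fun ε hε => ?_
  obtain ⟨δ, hδ, hLδ⟩ := exists_dist_circle_lt L (half_pos hε)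
  have hM : 0 < ‖L‖ * ‖L‖ + 1 := by positivity
  -- Each of the two errors gets `ε / 2`; the `+ 1` avoids division by zero when `L = 0`.
  refine ⟨min δ (ε / 2 / (‖L‖ * ‖L‖ + 1)), by positivity, fun τ hτ0 hτ t => ?_⟩
  have hτ1 : 0 < (τ : ℝ) := hτ0
  have hτδ : (τ : ℝ) < δ := hτ.trans_le (min_le_left _ _)
  have hτM : (‖L‖ * ‖L‖) * τ ≤ ε / 2 := by
    have := (lt_div_iff₀ hM).1 (hτ.trans_le (min_le_right _ _))
    nlinarith
  have key := norm_sub_sub_smul_le (h := fun r => propagator Lam r (t - τ)) (a := t - τ) (b := t)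
    (y := L (t : AddCircle T)) (ε := ε) (by linarith)
    (fun r => hasDerivAt_propagator hLam hLam0 r _) (fun r hr => ?_)
  · rw [propagator_self hLam hLam0, sub_sub_cancel] at key
    have h1 : (((τ : ℝ) : ℂ)⁻¹ • (stepFamily hLam hLam0 τ - ContinuousMap.const (AddCircle T) 1) :
        C(AddCircle T, TraceMat d →L[ℂ] TraceMat d)) (t : AddCircle T) - L (t : AddCircle T) =
        (τ : ℝ)⁻¹ • (propagator Lam t (t - τ) - 1 - (τ : ℝ) • L (t : AddCircle T)) := by
      change ((τ : ℝ) : ℂ)⁻¹ • (propagator Lam t (t - τ) - 1) - L (t : AddCircle T) = _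
      rw [smul_sub (τ : ℝ)⁻¹, inv_smul_smul₀ hτ1.ne', ← Complex.ofReal_inv, Complex.coe_smul]
    rw [h1, norm_smul, norm_inv, Real.norm_of_nonneg hτ1.le, inv_mul_le_iff₀ hτ1, mul_comm (τ : ℝ)]
    exact key
  · have h1 : L (r : AddCircle T) * propagator Lam r (t - τ) - L (t : AddCircle T) =
        (L (r : AddCircle T) - L (t : AddCircle T)) +
          L (r : AddCircle T) * (propagator Lam r (t - τ) - 1) := by
      rw [mul_sub, mul_one]; abel
    rw [h1]
    have h2 := hLδ r t (by rw [abs_lt]; constructor <;> linarith [hr.1, hr.2])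
    have h3 : ‖L (r : AddCircle T) * (propagator Lam r (t - τ) - 1)‖ ≤ ‖L‖ * (‖L‖ * τ) := by
      refine (norm_mul_le _ _).trans (mul_le_mul (norm_coeff_le L _) ?_ (norm_nonneg _)
        (norm_nonneg L))
      refine (norm_propagator_sub_one_le hL hLam hLam0 hr.1).trans ?_
      exact mul_le_mul_of_nonneg_left (by linarith [hr.2]) (norm_nonneg L)
    refine (norm_add_le _ _).trans ?_
    linarith

variable (d T) in
/-- The semigroup of translations. -/
noncomputable def shiftSemigroup (τ : ℝ≥0) : FloquetSpace d T →L[ℂ] FloquetSpace d T :=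
  translation d T τ

include hL in
-- The quotient is multiplication by `τ⁻¹ (V_{t,t-τ} - 1)`, convergent in operator norm, applied to
-- the translate of `f`, convergent to `f`. No regularity of `f` enters, so the two generators share
-- their domain.
theorem tendsto_pointwiseOp_stepFamily (f : FloquetSpace d T) :
    Tendsto (fun τ : ℝ≥0 => ((τ : ℝ) : ℂ)⁻¹ • (evolution hLam hLam0 τ f -
      shiftSemigroup d T τ f)) (𝓝[>] 0) (𝓝 (pointwiseOp L f)) := by
  have h1 : Tendsto (fun τ : ℝ≥0 => shiftSemigroup d T τ f) (𝓝[>] 0) (𝓝 f) := by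
    have h := (isContractionSemigroup_translation d T).continuous f
    exact (h.tendsto' 0 f (by simp [translation_zero])).mono_left nhdsWithin_le_nhds
  have h2 : Tendsto (fun τ : ℝ≥0 => pointwiseOpL (((τ : ℝ) : ℂ)⁻¹ • (stepFamily hLam hLam0 τ -
      ContinuousMap.const (AddCircle T) 1))) (𝓝[>] 0) (𝓝 (pointwiseOpL L)) :=
    (pointwiseOpL.continuous.tendsto L).comp (tendsto_stepFamily_sub_one hL hLam hLam0)
  have h3 : Continuous fun p : (FloquetSpace d T →L[ℂ] FloquetSpace d T) × FloquetSpace d T =>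
      p.1 p.2 := continuous_fst.clm_apply continuous_snd
  refine ((h3.tendsto (pointwiseOpL L, f)).comp (h2.prodMk_nhds h1)).congr fun τ => ?_
  simp only [Function.comp]
  rw [map_smul, map_sub, pointwiseOpL_apply, pointwiseOpL_apply, pointwiseOp_const_one]
  rfl

include hL in
theorem mem_graph_generator_evolution {f g : FloquetSpace d T} :
    (f, g) ∈ (generator (evolution hLam hLam0)).graph ↔
      (f, g - pointwiseOp L f) ∈ (generator (shiftSemigroup d T)).graph := by
  have h := tendsto_pointwiseOp_stepFamily hL hLam hLam0 f
  rw [mem_graph_generator, mem_graph_generator]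
  constructor
  · intro h1
    refine (h1.sub h).congr fun τ => ?_
    rw [← smul_sub]
    congr 1
    abel
  · intro h1
    have h2 := h1.add h
    rw [sub_add_cancel] at h2
    refine h2.congr fun τ => ?_
    rw [← smul_add]
    congr 1
    abel

theorem hasDerivAt_circleC1 (f : circleC1 d T) (t : ℝ) :
    HasDerivAt (fun s : ℝ => f.1 (s : AddCircle T)) (circleDeriv f (t : AddCircle T)) t :=
  ((contDiff_of_mem f).differentiable one_ne_zero t).hasDerivAt

/-- Uniform continuity of the derivative makes the difference quotients converge uniformly, hence in
the Bochner space. -/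
theorem circleC1_mem_graph_generator (f : circleC1 d T) :
    (contToFloquet f.1, -contToFloquet (circleDeriv f)) ∈
      (generator (shiftSemigroup d T)).graph := by
  rw [mem_graph_generator]
  have h : Tendsto (fun τ : ℝ≥0 => ((τ : ℝ) : ℂ)⁻¹ • (f.1.comp
      ⟨fun t : AddCircle T => t - ((τ : ℝ) : AddCircle T), by fun_prop⟩ - f.1)) (𝓝[>] 0)
      (𝓝 (-circleDeriv f)) := by
    refine tendsto_continuousMap_of_forall_coe fun ε hε => ?_
    obtain ⟨δ, hδ, hfδ⟩ := exists_dist_circle_lt (circleDeriv f) hε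
    refine ⟨δ, hδ, fun τ hτ0 hτ t => ?_⟩
    have hτ1 : 0 < (τ : ℝ) := hτ0
    have key := norm_sub_sub_smul_le (a := t - τ) (b := t) (ε := ε)
      (y := circleDeriv f (t : AddCircle T)) (by linarith) (hasDerivAt_circleC1 f)
      (fun r hr => (hfδ r t (by rw [abs_lt]; constructor <;> linarith [hr.1, hr.2])).le)
    rw [sub_sub_cancel] at key
    have h1 : (((τ : ℝ) : ℂ)⁻¹ • (f.1.comp ⟨fun t : AddCircle T => t - ((τ : ℝ) : AddCircle T),
        by fun_prop⟩ - f.1)) (t : AddCircle T) - (-circleDeriv f) (t : AddCircle T) =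
        -((τ : ℝ)⁻¹ • (f.1 (t : AddCircle T) - f.1 ((t - τ : ℝ) : AddCircle T) -
          (τ : ℝ) • circleDeriv f (t : AddCircle T))) := by
      rw [smul_sub (τ : ℝ)⁻¹, inv_smul_smul₀ hτ1.ne', ← Complex.ofReal_inv, neg_sub, AddCircle.coe_sub,
        Complex.coe_smul, ContinuousMap.neg_apply, sub_neg_eq_add, ContinuousMap.smul_apply,
        ContinuousMap.sub_apply, smul_sub, smul_sub]
      simp only [ContinuousMap.comp_apply, ContinuousMap.coe_mk]
      abel
    rw [h1, norm_neg, norm_smul, norm_inv, Real.norm_of_nonneg hτ1.le, inv_mul_le_iff₀ hτ1,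
      mul_comm (τ : ℝ)]
    exact key
  rw [← map_neg]
  refine ((contToFloquet.continuous.tendsto _).comp h).congr fun τ => ?_
  rw [Function.comp, map_smul, map_sub, ← translation_contToFloquet]
  rfl

end Generator

end Howland

namespace Howland

/-! ### Fourier analysis of the translation generator -/

section Fourier

variable {d : ℕ} {T : ℝ} [Fact (0 < T)]

theorem integrable_floquet (f : FloquetSpace d T) :
    Integrable f (@AddCircle.haarAddCircle T _) :=
  (Lp.memLp f).integrable (by norm_num)

theorem continuous_fourierCoeff (n : ℤ) :
    Continuous fun f : FloquetSpace d T => fourierCoeff (f : AddCircle T → TraceMat d) n := by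
  -- The coefficient is the integral of a Hölder product of two square integrable functions, with
  -- values in `L¹`.
  let B : FloquetSpace d T → Lp (TraceMat d) 1 (@AddCircle.haarAddCircle T _) := fun f =>
    (ContinuousLinearMap.lsmul ℂ ℂ).holderL AddCircle.haarAddCircle 2 2 1 (fourierLp 2 (-n)) f
  have hB : Continuous B := ContinuousLinearMap.continuous _
  refine (continuous_integral.comp hB).congr fun f => ?_
  refine integral_congr_ae ?_
  filter_upwards [(ContinuousLinearMap.lsmul ℂ ℂ).coeFn_holder (r := 1)
    (fourierLp 2 (-n) : Lp ℂ 2 (@AddCircle.haarAddCircle T _)) f, coeFn_fourierLp 2 (-n)]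
    with t h1 h2
  rw [← h2]
  exact h1

variable (d T) in
/-- The Fourier coefficient, as a continuous linear map on the Bochner space. -/
noncomputable def fourierCoeffL (n : ℤ) : FloquetSpace d T →L[ℂ] TraceMat d where
  toFun f := fourierCoeff (f : AddCircle T → TraceMat d) n
  map_add' f g := by
    rw [← Pi.add_apply (fourierCoeff _), ← fourierCoeff.add (integrable_floquet f)
      (integrable_floquet g), fourierCoeff_congr_ae (Lp.coeFn_add f g)]
  map_smul' c f := by
    rw [RingHom.id_apply, ← fourierCoeff.const_smul, fourierCoeff_congr_ae (Lp.coeFn_smul c f)]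
  cont := continuous_fourierCoeff n

theorem fourierCoeffL_apply (n : ℤ) (f : FloquetSpace d T) :
    fourierCoeffL d T n f = fourierCoeff (f : AddCircle T → TraceMat d) n := rfl

theorem odot_add_left (a b : TraceMat d) (h : Lp ℂ 2 (@AddCircle.haarAddCircle T _)) :
    odot (a + b) h = odot a h + odot b h := by
  rw [← algIota_tmul, ← algIota_tmul, ← algIota_tmul, ← map_add]
  exact congrArg _ (TensorProduct.add_tmul _ _ _)

theorem odot_smul_left (c : ℂ) (a : TraceMat d) (h : Lp ℂ 2 (@AddCircle.haarAddCircle T _)) :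
    odot (c • a) h = c • odot a h := by
  rw [← algIota_tmul, ← algIota_tmul, ← map_smul]
  exact congrArg _ (TensorProduct.smul_tmul' _ _ _).symm

theorem fourierCoeff_odot (a : TraceMat d) (h : Lp ℂ 2 (@AddCircle.haarAddCircle T _)) (n : ℤ) :
    fourierCoeff (odot a h : AddCircle T → TraceMat d) n =
      fourierCoeff (h : AddCircle T → ℂ) n • a := by
  rw [fourierCoeff_congr_ae (odot_coeFn a h), fourierCoeff, fourierCoeff, ← integral_smul_const]
  simp only [smul_eq_mul, mul_smul]

/-- The `n`-th term `fₙ e^{inΩt}` of the Fourier series. -/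
noncomputable def fourierTerm (f : FloquetSpace d T) (n : ℤ) : FloquetSpace d T :=
  odot (fourierCoeff (f : AddCircle T → TraceMat d) n) (fourierLp 2 n)

/-- The trace norm is not a Hilbert norm, but by finite dimension every `f` is a finite sum of
simple tensors `a ⊗ h`. For these the claim is the scalar `L²` Fourier series of `h`, pushed through
the bounded map `odot a`. -/
theorem hasSum_fourierTerm (f : FloquetSpace d T) : HasSum (fourierTerm f) f := by
  obtain ⟨x, rfl⟩ := algIota_surjective f
  induction x using TensorProduct.induction_on with
  | zero =>
    change HasSum (fourierTerm (algIota (0 : AlgTensor d T))) (algIota (0 : AlgTensor d T))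
    have h : fourierTerm (0 : FloquetSpace d T) = fun _ => 0 := by
      funext n
      rw [fourierTerm, ← fourierCoeffL_apply, map_zero, ← zero_smul ℂ (0 : TraceMat d),
        odot_smul_left, zero_smul]
    rw [map_zero, h]
    exact hasSum_zero
  | tmul a h =>
    change HasSum (fourierTerm (odot a h)) (odot a h)
    have h1 := (odot a).hasSum (hasSum_fourier_series_L2 h)
    refine h1.congr_fun fun n => ?_
    simp only [fourierTerm, fourierCoeff_odot, odot_smul_left, map_smul]
  | add x y hx hy =>
    have key : ∀ x y : AlgTensor d T, HasSum (fourierTerm (algIota x)) (algIota x) →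
        HasSum (fourierTerm (algIota y)) (algIota y) →
        HasSum (fourierTerm (algIota (x + y))) (algIota (x + y)) := fun x y hf hg => by
      rw [map_add]
      refine (hf.add hg).congr_fun fun n => ?_
      simp only [fourierTerm]
      rw [← odot_add_left, ← fourierCoeffL_apply, map_add]
      rfl
    exact key x y hx hy

theorem fourierCoeff_translation (τ : ℝ) (f : FloquetSpace d T) (n : ℤ) :
    fourierCoeff (translation d T τ f : AddCircle T → TraceMat d) n =
      fourier (-n) (τ : AddCircle T) • fourierCoeff (f : AddCircle T → TraceMat d) n := by
  rw [fourierCoeff_congr_ae (translation_coeFn τ f), fourierCoeff, fourierCoeff, ← integral_smul,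
    ← integral_sub_right_eq_self (fun t => fourier (-n) (τ : AddCircle T) •
      fourier (-n) t • f t) (τ : AddCircle T)]
  refine integral_congr_ae (Eventually.of_forall fun t => ?_)
  simp only
  rw [smul_smul]
  congr 1
  have : ∀ u v : AddCircle T, fourier (-n) (u + v) = fourier (-n) u * fourier (-n) v := fun u v => by
    simp [fourier_apply, smul_add, AddCircle.toCircle_add]
  rw [← this, add_sub_cancel]

/-- Translation by `τ` multiplies the `n`-th coefficient by `e^{-inΩτ}`; the factor is its
derivative at `τ = 0`. -/
theorem fourierCoeff_of_mem_graph_generator {f g : FloquetSpace d T}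
    (h : (f, g) ∈ (generator (shiftSemigroup d T)).graph) (n : ℤ) :
    fourierCoeff (g : AddCircle T → TraceMat d) n =
      (-(Complex.I * (2 * Real.pi / T : ℝ)) * n) •
        fourierCoeff (f : AddCircle T → TraceMat d) n := by
  rw [mem_graph_generator] at h
  have h1 := ((fourierCoeffL d T n).continuous.tendsto g).comp h
  have hd : HasDerivAt (fun x : ℝ => fourier (-n) (x : AddCircle T))
      (-(Complex.I * (2 * Real.pi / T : ℝ)) * n) 0 := by
    have := hasDerivAt_fourier_neg T n 0
    refine this.congr_deriv ?_
    rw [QuotientAddGroup.mk_zero, fourier_eval_zero]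
    push_cast
    ring
  have h2 : Tendsto (fun τ : ℝ≥0 => (τ : ℝ)) (𝓝[>] 0) (𝓝[≠] 0) := by
    refine tendsto_nhdsWithin_iff.2 ⟨?_, ?_⟩
    · exact (NNReal.continuous_coe.tendsto' 0 0 rfl).mono_left nhdsWithin_le_nhds
    · filter_upwards [self_mem_nhdsWithin] with r hr
      exact NNReal.coe_ne_zero.2 (ne_of_gt hr)
  have h3 := ((hasDerivAt_iff_tendsto_slope.1 hd).comp h2).smul_const
    (fourierCoeff (f : AddCircle T → TraceMat d) n)
  refine tendsto_nhds_unique h1 (h3.congr fun τ => ?_)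
  simp only [Function.comp, slope, vsub_eq_sub, sub_zero, QuotientAddGroup.mk_zero,
    fourier_eval_zero]
  rw [map_smul, map_sub, fourierCoeffL_apply, fourierCoeffL_apply, shiftSemigroup,
    fourierCoeff_translation, ← Complex.ofReal_inv, Complex.coe_smul, smul_assoc, sub_smul, one_smul]

/-- The function `t ↦ e^{inΩt} a`. -/
noncomputable def fourierC1 (n : ℤ) (a : TraceMat d) : circleC1 d T :=
  ⟨⟨fun t => fourier n t • a, by fun_prop⟩, by
    change ContDiff ℝ 1 fun t : ℝ => fourier n (t : AddCircle T) • a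
    have h1 : ContDiff ℝ 1 fun t : ℝ => 2 * (Real.pi : ℂ) * Complex.I * n * t / T :=
      (contDiff_const.mul Complex.ofRealCLM.contDiff).div_const _
    have h2 : ContDiff ℝ 1 fun t : ℝ => fourier n (t : AddCircle T) := by
      simp only [fourier_coe_apply]
      exact h1.cexp
    exact h2.smul contDiff_const⟩

theorem contToFloquet_fourierC1 (n : ℤ) (a : TraceMat d) :
    contToFloquet (fourierC1 (T := T) n a).1 = odot a (fourierLp 2 n) := by
  refine Lp.ext ?_
  filter_upwards [ContinuousMap.coeFn_toLp (p := 2) (𝕜 := ℂ) AddCircle.haarAddCircle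
    (fourierC1 (T := T) n a).1, odot_coeFn a (fourierLp 2 n : Lp ℂ 2 (@AddCircle.haarAddCircle T _)),
    coeFn_fourierLp 2 n] with t h1 h2 h3
  rw [h2, h3]
  exact h1

theorem circleDeriv_fourierC1 (n : ℤ) (a : TraceMat d) :
    circleDeriv (fourierC1 (T := T) n a) =
      (Complex.I * (2 * Real.pi / T : ℝ) * n) • (fourierC1 (T := T) n a).1 := by
  ext1 u
  induction u using QuotientAddGroup.induction_on with | _ t
  refine (hasDerivAt_circleC1 (fourierC1 n a) t).unique ?_
  refine ((hasDerivAt_fourier T n t).smul_const a).congr_deriv ?_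
  rw [ContinuousMap.smul_apply]
  change _ = _ • (fourier n (t : AddCircle T) • a)
  rw [smul_smul]
  congr 1
  push_cast
  ring

/-- A trigonometric polynomial. -/
noncomputable def partialC1 (f : FloquetSpace d T) (s : Finset ℤ) : circleC1 d T :=
  ∑ n ∈ s, fourierC1 n (fourierCoeff (f : AddCircle T → TraceMat d) n)

theorem contToFloquet_partialC1 (f : FloquetSpace d T) (s : Finset ℤ) :
    contToFloquet (partialC1 f s).1 = ∑ n ∈ s, fourierTerm f n := by
  rw [partialC1, Submodule.coe_sum, map_sum]
  simp only [contToFloquet_fourierC1, fourierTerm]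

theorem contToFloquet_circleDeriv_partialC1 (f : FloquetSpace d T) (s : Finset ℤ) :
    contToFloquet (circleDeriv (partialC1 f s)) =
      (Complex.I * (2 * Real.pi / T : ℝ)) • ∑ n ∈ s, (n : ℂ) • fourierTerm f n := by
  rw [partialC1, map_sum, map_sum, Finset.smul_sum]
  refine Finset.sum_congr rfl fun n _ => ?_
  rw [circleDeriv_fourierC1, map_smul, contToFloquet_fourierC1, fourierTerm, mul_smul]

theorem frequency_ne_zero : Complex.I * (2 * Real.pi / T : ℝ) ≠ 0 := by
  have : 0 < T := Fact.out
  refine mul_ne_zero Complex.I_ne_zero (Complex.ofReal_ne_zero.2 ?_)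
  positivity

/-- The series is, up to the factor `-(iΩ)⁻¹`, the Fourier series of `g`, which always converges. So
the domain of the translation generator lies in that of `I ⊗ F_z`. -/
theorem hasSum_of_mem_graph_generator {f g : FloquetSpace d T}
    (h : (f, g) ∈ (generator (shiftSemigroup d T)).graph) :
    HasSum (fun n : ℤ => (n : ℂ) • fourierTerm f n)
      (-(Complex.I * (2 * Real.pi / T : ℝ))⁻¹ • g) := by
  refine ((hasSum_fourierTerm g).const_smul (-(Complex.I * (2 * Real.pi / T : ℝ))⁻¹)).congr_fun
    fun n => ?_
  rw [fourierTerm, fourierTerm, fourierCoeff_of_mem_graph_generator h, odot_smul_left, smul_smul]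
  congr 1
  rw [← mul_assoc, neg_mul_neg, inv_mul_cancel₀ frequency_ne_zero, one_mul]

/-- The partial sums are `C¹` and lie in the graph; the graph is closed. -/
theorem mem_graph_generator_of_hasSum {f h : FloquetSpace d T}
    (hs : HasSum (fun n : ℤ => (n : ℂ) • fourierTerm f n) h) :
    (f, -((Complex.I * (2 * Real.pi / T : ℝ)) • h)) ∈ (generator (shiftSemigroup d T)).graph := by
  have hcl : IsClosed ((generator (shiftSemigroup d T)).graph :
      Set (FloquetSpace d T × FloquetSpace d T)) :=
    (isContractionSemigroup_translation d T).isClosed_generator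
  have hlim := (hasSum_fourierTerm f).prodMk_nhds
    (hs.const_smul (Complex.I * (2 * Real.pi / T : ℝ))).neg
  refine hcl.mem_of_tendsto hlim (Eventually.of_forall fun s => ?_)
  have := circleC1_mem_graph_generator (partialC1 f s)
  rw [contToFloquet_partialC1, contToFloquet_circleDeriv_partialC1, Finset.smul_sum] at this
  simpa using this

/-- The core property of `C¹`: Fourier partial sums approximate in the graph norm. -/
theorem exists_circleC1_tendsto {f g : FloquetSpace d T}
    (h : (f, g) ∈ (generator (shiftSemigroup d T)).graph) :
    ∃ φ : Finset ℤ → circleC1 d T, Tendsto (fun s => contToFloquet (φ s).1) atTop (𝓝 f) ∧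
      Tendsto (fun s => -contToFloquet (circleDeriv (φ s))) atTop (𝓝 g) := by
  refine ⟨partialC1 f, ?_, ?_⟩
  · simp only [contToFloquet_partialC1]
    exact hasSum_fourierTerm f
  · simp only [contToFloquet_circleDeriv_partialC1]
    have h1 : Tendsto (fun s : Finset ℤ => ∑ n ∈ s, (n : ℂ) • fourierTerm f n) atTop _ :=
      hasSum_of_mem_graph_generator h
    have h2 := (h1.const_smul (Complex.I * (2 * Real.pi / T : ℝ))).neg
    rwa [smul_smul, mul_neg, mul_inv_cancel₀ frequency_ne_zero, neg_smul, one_smul, neg_neg] at h2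

theorem dense_C1Space : Dense (C1Space d T : Set (FloquetSpace d T)) := by
  intro f
  refine mem_closure_of_tendsto (hasSum_fourierTerm f) (Eventually.of_forall fun s => ?_)
  rw [← contToFloquet_partialC1]
  exact ⟨(partialC1 f s).1, (partialC1 f s).2, rfl⟩

end Fourier

end Howland

namespace Howland

/-! ### The generator is the closure of `L - ∂` -/

section GeneratorClosure

variable {d : ℕ} {T : ℝ} [Fact (0 < T)] {L : C(AddCircle T, TraceMat d →L[ℂ] TraceMat d)}
  {Lam : ℝ → TraceMat d →L[ℂ] TraceMat d}
  (hL : ∀ t, IsStandardForm (L t))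
  (hLam : ∀ t : ℝ, HasDerivAt Lam (L (t : AddCircle T) * Lam t) t) (hLam0 : Lam 0 = 1)

theorem mem_graph_derivOp_iff {p : FloquetSpace d T × FloquetSpace d T} :
    p ∈ (derivOp d T).graph ↔
      ∃ φ : circleC1 d T, p = (contToFloquet φ.1, contToFloquet (circleDeriv φ)) := by
  have key : ∀ φ : circleC1 d T, derivOp d T ((circleC1 d T).equivMapOfInjective
      contToFloquetₗ contToFloquet_injective φ) = contToFloquet (circleDeriv φ) := fun φ => by
    change contToFloquetₗ (circleDeriv (((circleC1 d T).equivMapOfInjective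
      contToFloquetₗ contToFloquet_injective).symm _)) = _
    rw [LinearEquiv.symm_apply_apply]
    rfl
  rw [LinearPMap.mem_graph_iff']
  constructor
  · rintro ⟨y, rfl⟩
    obtain ⟨φ, rfl⟩ := ((circleC1 d T).equivMapOfInjective contToFloquetₗ
      contToFloquet_injective).surjective y
    exact ⟨φ, Prod.ext rfl (key φ)⟩
  · rintro ⟨φ, rfl⟩
    exact ⟨_, Prod.ext rfl (key φ)⟩

theorem mem_graph_generalizedLindbladian_iff {f g : FloquetSpace d T} :
    (f, g) ∈ (generalizedLindbladian L).graph ↔ ∃ φ : circleC1 d T, f = contToFloquet φ.1 ∧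
      g = pointwiseOp L (contToFloquet φ.1) - contToFloquet (circleDeriv φ) := by
  have h : (f, g) ∈ (generalizedLindbladian L).graph ↔
      (f, pointwiseOp L f - g) ∈ (derivOp d T).graph := by
    simp only [LinearPMap.mem_graph_iff]
    constructor
    · rintro ⟨y, hy, hg⟩
      refine ⟨y, hy, ?_⟩
      rw [← hg, ← show (y : FloquetSpace d T) = f from hy]
      change derivOp d T y = pointwiseOp L y - (pointwiseOp L y + -derivOp d T y)
      abel
    · rintro ⟨y, hy, hg⟩
      refine ⟨y, hy, ?_⟩
      change pointwiseOp L y + -derivOp d T y = g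
      rw [hg, ← show (y : FloquetSpace d T) = f from hy]
      abel
  rw [h, mem_graph_derivOp_iff]
  refine exists_congr fun φ => ?_
  rw [Prod.mk.injEq]
  refine and_congr_right fun hf => ?_
  rw [hf, sub_eq_iff_eq_add, eq_sub_iff_add_eq, add_comm g, eq_comm]

include hL in
theorem generalizedLindbladian_le_generator :
    generalizedLindbladian L ≤ generator (evolution hLam hLam0) := by
  refine LinearPMap.le_of_le_graph fun p hp => ?_
  obtain ⟨f, g⟩ := p
  obtain ⟨φ, rfl, rfl⟩ := mem_graph_generalizedLindbladian_iff.1 hp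
  rw [mem_graph_generator_evolution hL, sub_sub_cancel_left]
  exact circleC1_mem_graph_generator φ

include hL in
-- Adding the bounded operator `L` preserves graph norm approximation, so the core property passes
-- from the translation generator to the full one.
theorem graph_generator_subset_closure :
    ((generator (evolution hLam hLam0)).graph : Set (FloquetSpace d T × FloquetSpace d T)) ⊆
      closure (generalizedLindbladian L).graph := by
  rintro ⟨f, g⟩ hp
  obtain ⟨φ, h1, h2⟩ := exists_circleC1_tendsto
    ((mem_graph_generator_evolution hL hLam hLam0).1 hp)
  have h3 := (((pointwiseOp L).continuous.tendsto f).comp h1).add h2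
  rw [add_sub_cancel] at h3
  refine mem_closure_of_tendsto (h1.prodMk_nhds h3) (Eventually.of_forall fun s => ?_)
  refine mem_graph_generalizedLindbladian_iff.2 ⟨φ s, rfl, ?_⟩
  rw [sub_eq_add_neg]
  rfl

include hL in
theorem dense_generator_evolution :
    Dense ((generator (evolution hLam hLam0)).domain : Set (FloquetSpace d T)) :=
  dense_C1Space.mono (generalizedLindbladian_le_generator hL hLam hLam0).1

end GeneratorClosure

/-! ### Fourier lifting to the tensor product -/

section Lift

variable {d : ℕ} {T : ℝ} [Fact (0 < T)]

theorem mem_graph_liftPMap_iff {A : FloquetSpace d T →ₗ.[ℂ] FloquetSpace d T}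
    {x y : FloquetTensor d T} : (x, y) ∈ (liftPMap A).graph ↔ (iota x, iota y) ∈ A.graph := by
  simp only [LinearPMap.mem_graph_iff]
  constructor
  · rintro ⟨z, hz, rfl⟩
    refine ⟨⟨iota z.1, z.2⟩, congrArg iota hz, ?_⟩
    rw [liftPMap_apply, LinearIsometryEquiv.apply_symm_apply]
  · rintro ⟨z, hz, hy⟩
    have hz' : (z : FloquetSpace d T) = iota x := hz
    have hx : x ∈ (liftPMap A).domain := by
      change iota x ∈ A.domain
      rw [← hz']
      exact z.2
    refine ⟨⟨x, hx⟩, rfl, ?_⟩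
    rw [liftPMap_apply, LinearIsometryEquiv.symm_apply_eq, ← hy]
    exact congrArg A (Subtype.ext hz'.symm)

/-- The isometry `ι` intertwines the difference quotients and, being a homeomorphism, both preserves
and reflects their convergence. -/
theorem generator_fourierLift (W : ℝ≥0 → FloquetSpace d T →L[ℂ] FloquetSpace d T) :
    generator (fun τ => fourierLift (W τ)) = liftPMap (generator W) := by
  refine LinearPMap.eq_of_eq_graph (Submodule.ext fun p => ?_)
  obtain ⟨x, y⟩ := p
  rw [mem_graph_liftPMap_iff, mem_graph_generator, mem_graph_generator]
  refine (iota (d := d) (T := T)).toHomeomorph.isInducing.tendsto_nhds_iff.trans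
    (tendsto_congr fun τ => ?_)
  change iota _ = _
  rw [map_smul, map_sub, fourierLift_apply, LinearIsometryEquiv.apply_symm_apply]

theorem isContractionSemigroup_fourierLift {W : ℝ≥0 → FloquetSpace d T →L[ℂ] FloquetSpace d T}
    (hW : IsContractionSemigroup W) : IsContractionSemigroup fun τ => fourierLift (W τ) where
  zero := by
    ext x
    rw [fourierLift_apply, hW.zero]
    simp
  add s t := by
    refine ContinuousLinearMap.ext fun x => ?_
    rw [ContinuousLinearMap.mul_def, ContinuousLinearMap.comp_apply]
    simp only [fourierLift_apply, LinearIsometryEquiv.apply_symm_apply]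
    rw [hW.add_apply]
  continuous x := iota.symm.continuous.comp (hW.continuous (iota x))
  contraction t := by
    refine ContinuousLinearMap.opNorm_le_bound _ zero_le_one fun x => ?_
    rw [one_mul, fourierLift_apply, LinearIsometryEquiv.norm_map]
    exact (hW.norm_apply_le t _).trans_eq (LinearIsometryEquiv.norm_map _ _)

theorem liftPMap_mono {A B : FloquetSpace d T →ₗ.[ℂ] FloquetSpace d T} (h : A ≤ B) :
    liftPMap A ≤ liftPMap B := by
  refine LinearPMap.le_of_le_graph fun p hp => ?_
  obtain ⟨x, y⟩ := p
  rw [mem_graph_liftPMap_iff] at hp ⊢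
  exact LinearPMap.le_graph_of_le h hp

theorem graph_liftPMap_subset_closure {A B : FloquetSpace d T →ₗ.[ℂ] FloquetSpace d T}
    (h : (B.graph : Set (FloquetSpace d T × FloquetSpace d T)) ⊆ closure A.graph) :
    ((liftPMap B).graph : Set (FloquetTensor d T × FloquetTensor d T)) ⊆
      closure (liftPMap A).graph := by
  let e := (iota (d := d) (T := T)).toHomeomorph.prodCongr (iota (d := d) (T := T)).toHomeomorph
  have hA : ∀ A : FloquetSpace d T →ₗ.[ℂ] FloquetSpace d T,
      ((liftPMap A).graph : Set (FloquetTensor d T × FloquetTensor d T)) = e ⁻¹' A.graph := fun A =>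
    Set.ext fun p => mem_graph_liftPMap_iff
  rw [hA, hA, ← e.preimage_closure]
  exact Set.preimage_mono h

theorem dense_domain_liftPMap {A : FloquetSpace d T →ₗ.[ℂ] FloquetSpace d T}
    (h : Dense (A.domain : Set (FloquetSpace d T))) :
    Dense ((liftPMap A).domain : Set (FloquetTensor d T)) :=
  h.preimage (iota (d := d) (T := T)).toHomeomorph.isOpenMap

theorem iota_numberTerm (n : ℤ) (x : FloquetTensor d T) :
    iota (numberTerm n x) = (n : ℂ) • fourierTerm (iota x) n := by
  change iota (tensor _ _) = _
  rw [iota_tensor, map_smul, fourierTerm]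

theorem hasSum_numberTerm_iff {x y : FloquetTensor d T} :
    HasSum (fun n : ℤ => numberTerm n x) y ↔
      HasSum (fun n : ℤ => (n : ℂ) • fourierTerm (iota x) n) (iota y) := by
  simp only [← iota_numberTerm]
  exact ((iota (d := d) (T := T)).toContinuousLinearEquiv.hasSum' (f := fun n : ℤ => numberTerm n x)).symm

theorem mem_graph_liftedLindbladian_iff {L : C(AddCircle T, TraceMat d →L[ℂ] TraceMat d)}
    {x y : FloquetTensor d T} : (x, y) ∈ (liftedLindbladian L).graph ↔
      ∃ z, HasSum (fun n : ℤ => numberTerm n x) z ∧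
        y = fourierLift (pointwiseOp L) x - (Complex.I * (2 * Real.pi / T : ℝ)) • z := by
  rw [LinearPMap.mem_graph_iff]
  constructor
  · rintro ⟨w, hw, hy⟩
    change (w : FloquetTensor d T) = x at hw
    subst hw
    refine ⟨∑' n : ℤ, numberTerm n w.1, Summable.hasSum w.2, ?_⟩
    refine Eq.trans (Eq.symm hy) ?_
    rw [sub_eq_add_neg]
    rfl
  · rintro ⟨z, hz, rfl⟩
    have hx : x ∈ (liftedLindbladian L).domain := hz.summable
    refine ⟨⟨x, hx⟩, rfl, ?_⟩
    rw [← hz.tsum_eq, sub_eq_add_neg]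
    rfl

variable {L : C(AddCircle T, TraceMat d →L[ℂ] TraceMat d)} {Lam : ℝ → TraceMat d →L[ℂ] TraceMat d}
  (hL : ∀ t, IsStandardForm (L t))
  (hLam : ∀ t : ℝ, HasDerivAt Lam (L (t : AddCircle T) * Lam t) t) (hLam0 : Lam 0 = 1)

include hL in
-- After removal of the bounded part `L`, this is the equivalence between membership in the domain
-- of the translation generator and convergence of `∑ n fₙ eₙ`, carried through `ι`.
theorem liftPMap_generator_evolution :
    liftPMap (generator (evolution hLam hLam0)) = liftedLindbladian L := by
  refine LinearPMap.eq_of_eq_graph (Submodule.ext fun p => ?_)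
  obtain ⟨x, y⟩ := p
  rw [mem_graph_liftPMap_iff, mem_graph_generator_evolution hL, mem_graph_liftedLindbladian_iff]
  constructor
  · intro h
    have h1 := hasSum_of_mem_graph_generator h
    -- Writing the sum as an image under `ι` exhibits the witness `z`, the value of `I ⊗ F_z` at
    -- `x`.
    rw [← iota.apply_symm_apply (-(Complex.I * (2 * Real.pi / T : ℝ))⁻¹ •
      (iota y - pointwiseOp L (iota x))), ← hasSum_numberTerm_iff] at h1
    refine ⟨_, h1, iota.injective ?_⟩
    rw [map_sub, map_smul, fourierLift_apply, iota.apply_symm_apply, iota.apply_symm_apply,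
      smul_smul, mul_neg, mul_inv_cancel₀ frequency_ne_zero, neg_smul, one_smul]
    abel
  · rintro ⟨z, hz, rfl⟩
    rw [map_sub, fourierLift_apply, iota.apply_symm_apply, sub_sub_cancel_left, map_smul]
    exact mem_graph_generator_of_hasSum (hasSum_numberTerm_iff.1 hz)

include hL hLam hLam0 in
theorem liftPMap_generalizedLindbladian_eq :
    liftPMap (generalizedLindbladian L) = (liftedLindbladian L).domRestrict
      ((C1Space d T).comap (iota (d := d) (T := T)).toLinearEquiv.toLinearMap) := by
  -- The inclusion comes from that of `L - ∂` in the generator; it contains the fact that `C¹`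
  -- functions lie in the domain of `I ⊗ F_z`, so the restricted domain is all of `ι⁻¹(C¹)`.
  have hle : liftPMap (generalizedLindbladian L) ≤ liftedLindbladian L := by
    rw [← liftPMap_generator_evolution hL hLam hLam0]
    exact liftPMap_mono (generalizedLindbladian_le_generator hL hLam hLam0)
  refine LinearPMap.dExt (le_antisymm (fun x hx => ⟨hx, hle.1 hx⟩) fun x hx => hx.1)
    fun x y hxy => ?_
  refine (hle.2 (x := x) (y := ⟨y, y.2.2⟩) hxy).trans ?_
  exact (LinearPMap.domRestrict_apply (f := liftedLindbladian L) (x := y) (y := ⟨y, y.2.2⟩)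
    rfl).symm

end Lift

end Howland

theorem mainTheorem1 {d : ℕ} (hd : 1 ≤ d) {T : ℝ} [Fact (0 < T)]
    (L : C(AddCircle T, TraceMat d →L[ℂ] TraceMat d)) (hL : ∀ t, IsStandardForm (L t))
    (Lam : ℝ → TraceMat d →L[ℂ] TraceMat d)
    (hLam : ∀ t : ℝ, HasDerivAt Lam (L (t : AddCircle T) * Lam t) t) (hLam0 : Lam 0 = 1) :
    (∀ s t : ℝ, s ≤ t → IsCP (propagator Lam t s) ∧ IsTP (propagator Lam t s)) ∧
    ∃ W : ℝ≥0 → FloquetSpace d T →L[ℂ] FloquetSpace d T,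
      IsHowlandFamily Lam W ∧
      (IsContractionSemigroup W ∧ IsStronglyDifferentiable W ∧
        (∀ τ, IsCPBochner (W τ) ∧ IsTPBochner (W τ)) ∧
        IsGeneratedByClosure W (generalizedLindbladian L)) ∧
      (IsContractionSemigroup (fun τ => fourierLift (W τ)) ∧
        IsStronglyDifferentiable (fun τ => fourierLift (W τ)) ∧
        (∀ τ, IsCPTensor (fourierLift (W τ)) ∧ IsTPTensor (fourierLift (W τ))) ∧
        IsGeneratedByClosure (fun τ => fourierLift (W τ))
          (liftPMap (generalizedLindbladian L)) ∧
        liftPMap (generalizedLindbladian L) =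
          (liftedLindbladian L).domRestrict
            ((C1Space d T).comap (iota (d := d) (T := T)).toLinearEquiv.toLinearMap) ∧
        generator (fun τ => fourierLift (W τ)) = liftedLindbladian L) := by
  have hW := isContractionSemigroup_evolution hLam hLam0 hL
  have hWl := isContractionSemigroup_fourierLift hW
  have hgen := generator_fourierLift (evolution hLam hLam0)
  refine ⟨fun s t hst => ⟨isCP_propagator hL hLam hLam0 hst, isTP_propagator hL hLam hLam0 t s⟩,
    evolution hLam hLam0, isHowlandFamily_evolution hLam hLam0,
    ⟨hW, hW.isStronglyDifferentiable (dense_generator_evolution hL hLam hLam0),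
      fun τ => ⟨isCPBochner_evolution hL hLam hLam0 τ, isTPBochner_evolution hL hLam hLam0 τ⟩,
      closable_and_eq_closure hW.isClosed_generator
        (generalizedLindbladian_le_generator hL hLam hLam0)
        (graph_generator_subset_closure hL hLam hLam0)⟩,
    hWl, hWl.isStronglyDifferentiable ?_,
    fun τ => ⟨isCPTensor_fourierLift (isCPBochner_evolution hL hLam hLam0 τ),
      isTPTensor_fourierLift (isTPBochner_evolution hL hLam hLam0 τ)⟩,
    closable_and_eq_closure hWl.isClosed_generator ?_ ?_,
    liftPMap_generalizedLindbladian_eq hL hLam hLam0,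
    hgen.trans (liftPMap_generator_evolution hL hLam hLam0)⟩
  · rw [hgen]
    exact dense_domain_liftPMap (dense_generator_evolution hL hLam hLam0)
  · rw [hgen]
    exact liftPMap_mono (generalizedLindbladian_le_generator hL hLam hLam0)
  · rw [hgen]
    exact graph_liftPMap_subset_closure (graph_generator_subset_closure hL hLam hLam0)
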